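/- **Setting.** Let $K$ be a field and $\mathcal D$ a finite-dimensional commutative $K$-algebra, $\mathcal D\cong\mathcal D_1\times\cdots\times\mathcal D_t$ with $\mathcal D_i$ local with maximal ideal $\mathfrak m_i$ and residue field $K$. For $0\ne x\in\mathcal D_i$ let $\nu_i(x)$ be the $r$ with $x\in\mathfrak m_i^r\setminus\mathfrak m_i^{r+1}$. Fix a ranked basis $\bar\epsilon=(\epsilon_{i,j})_{1\le i\le t,\,0\le j\le m_i}$ of $\mathcal D$: for each $i$, $(\epsilon_{i,j})_{0\le j\le m_i}$ is a $K$-basis of $\mathcal D_i$ with $\epsilon_{i,0}\in K^*$, $\epsilon_{i,j}\in\mathfrak m_i$ for $j\geq 1$, $\nu_i(\epsilon_{i,j})\le\nu_i(\epsilon_{i,k})$ for $1\le j<k$, and every power $\mathfrak m_i^r$ is the $K$-span of the $\epsilon_{i,j}$ that it contains (i.e. the basis is a concatenation of lifts of bases of the quotients $\mathfrak m_i^r/\mathfrak m_i^{r+1}$). A $\mathcal D$-ring is a commutative $K$-algebra $R$ with a $K$-algebra homomorphism $e:R\to R\otimes_K\mathcal D$, $e(r)=\sum\delta_{i,j}(r)\otimes\epsilon_{i,j}$;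 write $\sigma_i=\delta_{i,0}$. Let $(R,e)$ be a $\mathcal D^*$-ring, that is, $e$ satisfies $(\mathrm{id}_R\otimes\beta)\circ(e\otimes\mathrm{id})\circ e=(e\otimes\mathrm{id})\circ e$ with $\beta$ the flip of $\mathcal D\otimes\mathcal D$ (equivalently, the $\delta_{i,j}$ commute pairwise), and assume that all $\sigma_i:R\to R$ are injective. Let $M=\dim_K\mathcal D$ and $\bar x=(x_1,\dots,x_n)$. The $\mathcal D^*$-polynomial ring $R\{\bar x\}_{\mathcal D^*}$ is the polynomial ring over $R$ in the indeterminates $d^\theta x_l$ ($1\le l\le n$, $\theta\in\mathbb N^{M}$), with the $\mathcal D$-ring structure extending $e$ such that $\delta_{i,j}(d^\theta x_l)=d^{\theta+1_{i,j}}x_l$. An ideal $I$ of a $\mathcal D$-ring $(S,e)$ is a $\mathcal D$-ideal if $e(I)\subseteq I\otimes_K\mathcal D$ (equivalently, all $\delta_{i,j}(I)\subseteq I$); a $\mathcal D$-ideal is reflexive if $a\,\sigma_i(a)\in I$ implies $a\in I$ for all $a\in S$ and all $i$, and perfect if it is reflexive and radical. $\langle\Sigma\rangle_{\mathcal D}$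 denotes the smallest reflexive $\mathcal D$-ideal containing $\Sigma$, and $I:s^\infty=\{r : rs^N\in I\text{ for some }N\in\mathbb N\}$. Fix a ranking: a total order on the indeterminates such that, for all indeterminates $u,v$ and all operators $\delta=\delta_{i,j}$, $u<\delta(u)$; $u<v$ implies $\delta(u)<\delta(v)$; and $\nu_i(\epsilon_{i,j})<\nu_i(\epsilon_{i,k})$ implies $\delta_{i,j}(u)<\delta_{i,k}(u)$. For $f\in R\{\bar x\}_{\mathcal D^*}\setminus R$, the leader $u_f$ is the largest indeterminate in $f$, $\deg f$ is the degree of $f$ in $u_f$, the initial $I_f$ is the coefficient of $u_f^{\deg f}$ in $f$, the separant is $s_f=\partial f/\partial u_f$, and $\mathrm{rk}(f)=(u_f,\deg f)$, ordered lexicographically. A transform $d^{\theta+\eta}x_l$ of $d^\theta x_l$ is a $\delta$-transform if $\eta_{i,j}>0$ for some $i$ and some $j\geq1$, and a $\sigma$-transform otherwise. A polynomial $g$ is reduced with respect to $f\notin R$ if no $\delta$-transform of $u_f$ occurs in $g$ and every $\sigma$-transform of $u_f$ (including $u_f$) that occurs in $g$ has degree $<\deg f$ in $g$. A set $A\subseteq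 R\{\bar x\}_{\mathcal D^*}\setminus R$ is autoreduced if each element is reduced with respect to every other element. For autoreduced $A=\{a_1,\dots,a_k\}$ and $B=\{b_1,\dots,b_l\}$, listed by increasing rank, $A\prec B$ means that either $\mathrm{rk}(a_i)<\mathrm{rk}(b_i)$ for some $i\le\min(k,l)$ and $\mathrm{rk}(a_j)=\mathrm{rk}(b_j)$ for all $j<i$, or $l<k$ and $\mathrm{rk}(a_i)=\mathrm{rk}(b_i)$ for all $i\le l$. A characteristic set of an ideal $I$ is a $\prec$-minimal element of the collection of all autoreduced sets $A\subseteq I$ such that $s_f\notin I$ for every $f\in A$. **Lemma.** Assume moreover that $R$ is a $\mathbb Q$-algebra. Let $P$ be a prime perfect $\mathcal D$-ideal of $R\{\bar x\}_{\mathcal D^*}$ and $\mathcal C$ a characteristic set of $P$. Then $\mathcal C$ is finite, and with $H=\prod_{c\in\mathcal C}I_cs_c$ and $B=P\cap R$, $$H\notin P\qquad\text{and}\qquad P=\langle\mathcal C\cup B\rangle_{\mathcal D}:H^\infty .$$ -/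

import Mathlib

open scoped TensorProduct

noncomputable section

namespace DStar

/-! ### `𝒟`-rings -/

section DRings

variable {K : Type*} [Field K] {D : Type*} [CommRing D] [Algebra K D]
variable {R : Type*} [CommRing R] [Algebra K R]

/-- The coordinate maps `δ_k : R → R` of a `𝒟`-ring structure `e : R → R ⊗ 𝒟` with respect to a
`K`-basis `b` of `𝒟`, determined by `e r = ∑ k, δ_k r ⊗ b k`. -/
def coord {κ : Type*} (e : R →ₐ[K] R ⊗[K] D) (b : Module.Basis κ K D) (k : κ) (r : R) : R :=
  (Algebra.TensorProduct.basis R b).repr (e r) k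

/-- `(R, e)` is a `𝒟*`-ring: `𝒟(e) ∘ e : R → R ⊗ 𝒟 ⊗ 𝒟` is invariant under the exchange of the
two factors `𝒟`, where `𝒟(e) = e ⊗ id`. -/
def IsCommuting (e : R →ₐ[K] R ⊗[K] D) : Prop :=
  ∀ r : R, TensorProduct.rightComm K R D D (LinearMap.rTensor D e.toLinearMap (e r)) =
    LinearMap.rTensor D e.toLinearMap (e r)

/-- A `𝒟`-ideal: `e(I) ⊆ I ⊗ 𝒟`, the extension of `I` along `R → R ⊗ 𝒟`. -/
def IsDIdeal (e : R →ₐ[K] R ⊗[K] D) (I : Ideal R) : Prop :=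
  ∀ a ∈ I, e a ∈ I.map (Algebra.TensorProduct.includeLeft : R →ₐ[K] R ⊗[K] D)

/-- A reflexive `𝒟`-ideal with respect to the maps `σ i`: `a * σ i a ∈ I` implies `a ∈ I`. -/
def IsReflexiveDIdeal {ι : Type*} (e : R →ₐ[K] R ⊗[K] D) (σ : ι → R → R) (I : Ideal R) : Prop :=
  IsDIdeal e I ∧ ∀ (a : R) (i : ι), a * σ i a ∈ I → a ∈ I

/-- A perfect `𝒟`-ideal: a reflexive `𝒟`-ideal which is a radical ideal. -/
def IsPerfectDIdeal {ι : Type*} (e : R →ₐ[K] R ⊗[K] D) (σ : ι → R → R) (I : Ideal R) : Prop :=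
  IsReflexiveDIdeal e σ I ∧ I.IsRadical

/-- The smallest reflexive `𝒟`-ideal `⟨S⟩_𝒟` containing `S`. -/
def reflexiveSpan {ι : Type*} (e : R →ₐ[K] R ⊗[K] D) (σ : ι → R → R) (S : Set R) : Ideal R :=
  sInf {J | IsReflexiveDIdeal e σ J ∧ S ⊆ J}

end DRings

/-- The saturation `I : s^∞ = {r | r * s ^ n ∈ I for some n}`. -/
def saturation {R : Type*} [CommRing R] (I : Ideal R) (s : R) : Ideal R where
  carrier := {r | ∃ n : ℕ, r * s ^ n ∈ I}
  zero_mem' := ⟨0, by simp⟩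
  add_mem' := by
    rintro a b ⟨n, hn⟩ ⟨k, hk⟩
    refine ⟨n + k, ?_⟩
    have h : (a + b) * s ^ (n + k) = s ^ k * (a * s ^ n) + s ^ n * (b * s ^ k) := by ring
    rw [h]
    exact I.add_mem (I.mul_mem_left _ hn) (I.mul_mem_left _ hk)
  smul_mem' := by
    rintro c a ⟨n, hn⟩
    refine ⟨n, ?_⟩
    rw [smul_eq_mul, mul_assoc]
    exact I.mul_mem_left _ hn

/-! ### Ranked bases -/

section RankedBases

variable {K : Type*} [Field K]

/-- For `x ≠ 0` in a local ring with nilpotent maximal ideal `𝔪`: the `r` with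
`x ∈ 𝔪 ^ r` and `x ∉ 𝔪 ^ (r + 1)`. -/
def nu {L : Type*} [CommRing L] [IsLocalRing L] (x : L) : ℕ :=
  sInf {r : ℕ | x ∈ IsLocalRing.maximalIdeal L ^ r ∧ x ∉ IsLocalRing.maximalIdeal L ^ (r + 1)}

/-- A ranked basis `ε 0, …, ε m` of a local `K`-algebra `L` with maximal ideal `𝔪`: `ε 0 ∈ K^*`,
the other elements lie in `𝔪` and are listed by increasing `nu`, and the basis is a concatenation
of (lifts of) bases of the quotients `𝔪 ^ r / 𝔪 ^ (r + 1)`, that is, every power `𝔪 ^ r` is the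
`K`-span of the basis elements that it contains. -/
structure IsRankedBasis {L : Type*} [CommRing L] [IsLocalRing L] [Algebra K L] {m : ℕ}
    (ε : Module.Basis (Fin (m + 1)) K L) : Prop where
  zero_mem_units : ∃ c : K, c ≠ 0 ∧ ε 0 = algebraMap K L c
  mem_maximalIdeal : ∀ j, j ≠ 0 → ε j ∈ IsLocalRing.maximalIdeal L
  nu_mono : ∀ j k, j ≠ 0 → j < k → nu (ε j) ≤ nu (ε k)
  span_eq : ∀ r : ℕ, (IsLocalRing.maximalIdeal L ^ r).restrictScalars K =
    Submodule.span K {x | x ∈ Set.range ε ∧ x ∈ IsLocalRing.maximalIdeal L ^ r}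

/-- Indices `(i, j)`, `0 ≤ j ≤ m i`, of the operators `δ_{i,j}`; the operator `(i, 0)` is `σ_i`. -/
abbrev OpIdx {ι : Type*} (m : ι → ℕ) : Type _ := (i : ι) × Fin (m i + 1)

/-- The basis of `𝒟 ≃ ∏ i, A i` which is the union of the bases `ε i` of the factors. -/
def unionBasis {ι : Type*} [Fintype ι] {D : Type*} [CommRing D] [Algebra K D]
    {A : ι → Type*} [∀ i, CommRing (A i)] [∀ i, Algebra K (A i)]
    (φ : D ≃ₐ[K] (∀ i, A i)) {m : ι → ℕ} (ε : ∀ i, Module.Basis (Fin (m i + 1)) K (A i)) :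
    Module.Basis (OpIdx m) K D :=
  (Pi.basis ε).map φ.symm.toLinearEquiv

end RankedBases

/-! ### The `𝒟*`-polynomial ring -/

/-- The indeterminate `d^θ x_j`, with `j = idx` and `θ = exp`. -/
@[ext] structure DVar (n : ℕ) (κ : Type*) where
  idx : Fin n
  exp : κ →₀ ℕ

/-- `d^θ x_j ↦ d^(θ + η) x_j`, the composition of operators with exponents `η`. -/
def DVar.shift {n : ℕ} {κ : Type*} (u : DVar n κ) (η : κ →₀ ℕ) : DVar n κ := ⟨u.idx, u.exp + η⟩

/-- `δ_k (d^θ x_j) = d^(θ + 1_k) x_j`. -/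
def DVar.op {n : ℕ} {κ : Type*} (k : κ) (u : DVar n κ) : DVar n κ := u.shift (Finsupp.single k 1)

/-- The underlying ring of the `𝒟*`-polynomial ring in `x_1, …, x_n`. -/
abbrev DPoly (n : ℕ) (κ : Type*) (R : Type*) [CommRing R] : Type _ := MvPolynomial (DVar n κ) R

/-- The `𝒟`-ring structure of the `𝒟*`-polynomial ring: the `K`-algebra homomorphism extending
`e` on coefficients with `d^θ x_j ↦ ∑ k, d^(θ + 1_k) x_j ⊗ b k`. -/
def polyHom {K : Type*} [Field K] {D : Type*} [CommRing D] [Algebra K D]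
    {R : Type*} [CommRing R] [Algebra K R] {κ : Type*} [Fintype κ] (n : ℕ)
    (e : R →ₐ[K] R ⊗[K] D) (b : Module.Basis κ K D) :
    DPoly n κ R →ₐ[K] DPoly n κ R ⊗[K] D where
  toRingHom := MvPolynomial.eval₂Hom
    (((Algebra.TensorProduct.map (IsScalarTower.toAlgHom K R (DPoly n κ R))
      (AlgHom.id K D)).comp e : R →ₐ[K] DPoly n κ R ⊗[K] D) : R →+* DPoly n κ R ⊗[K] D)
    (fun u => ∑ k, MvPolynomial.X (u.op k) ⊗ₜ[K] b k)
  commutes' := by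
    intro c
    rw [IsScalarTower.algebraMap_apply K R (DPoly n κ R), MvPolynomial.algebraMap_eq]
    simp

/-! ### Rankings, leaders, initials, separants -/

section Rankings

variable {ι : Type*} {m : ι → ℕ} {n : ℕ}

/-- A ranking of the indeterminates; `ν i j` is the `nu`-value of the basis element `(i, j)`. -/
structure IsRanking (ν : ∀ i, Fin (m i + 1) → ℕ) [LinearOrder (DVar n (OpIdx m))] : Prop where
  lt_op : ∀ (u : DVar n (OpIdx m)) (k : OpIdx m), u < u.op k
  op_lt_op : ∀ (u v : DVar n (OpIdx m)) (k : OpIdx m), u < v → u.op k < v.op k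
  op_lt_of_nu_lt : ∀ (i : ι) (j k : Fin (m i + 1)) (u : DVar n (OpIdx m)),
    ν i j < ν i k → u.op ⟨i, j⟩ < u.op ⟨i, k⟩

/-- The order `ord^δ(θ)`: the sum of the exponents of the operators `δ_{i,j}` with `j ≥ 1`. -/
def ordDelta (θ : OpIdx m →₀ ℕ) : ℕ := θ.sum fun k a => if k.2 = 0 then 0 else a

/-- `v` is a `δ`-transform of `u`. -/
def IsDeltaTransform (u v : DVar n (OpIdx m)) : Prop :=
  ∃ θ : OpIdx m →₀ ℕ, 0 < ordDelta θ ∧ v = u.shift θ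

/-- `v` is a `σ`-transform of `u`. -/
def IsSigmaTransform (u v : DVar n (OpIdx m)) : Prop :=
  ∃ θ : OpIdx m →₀ ℕ, ordDelta θ = 0 ∧ v = u.shift θ

variable {R : Type*} [CommRing R]

/-- For `f = ∑ g_a u^a` with `u` not occurring in the `g_a`, the coefficient `g_d`. -/
def coeffIn {V : Type*} (u : V) (d : ℕ) (f : MvPolynomial V R) : MvPolynomial V R :=
  ∑ s ∈ f.support with s u = d, MvPolynomial.monomial (s.erase u) (f.coeff s)

variable [LinearOrder (DVar n (OpIdx m))]

/-- The leader `u_f` of a polynomial `f ∉ R`. -/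
def leader (f : DPoly n (OpIdx m) R) (h : f.vars.Nonempty) : DVar n (OpIdx m) := f.vars.max' h

/-- The degree of `f ∉ R` in its leader. -/
def leadDeg (f : DPoly n (OpIdx m) R) (h : f.vars.Nonempty) : ℕ := f.degreeOf (leader f h)

open Classical in
/-- The initial `I_f` of `f ∉ R` (with junk value `0` for `f ∈ R`). -/
def initial (f : DPoly n (OpIdx m) R) : DPoly n (OpIdx m) R :=
  if h : f.vars.Nonempty then coeffIn (leader f h) (leadDeg f h) f else 0

open Classical in
/-- The separant `s_f = ∂f/∂u_f` of `f ∉ R` (with junk value `0` for `f ∈ R`). -/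
def separant (f : DPoly n (OpIdx m) R) : DPoly n (OpIdx m) R :=
  if h : f.vars.Nonempty then MvPolynomial.pderiv (leader f h) f else 0

open Classical in
/-- The rank of `f ∉ R`: the pair of its leader and its degree, ordered lexicographically (with
value `⊥` for `f ∈ R`). -/
def rk (f : DPoly n (OpIdx m) R) : WithBot (DVar n (OpIdx m) ×ₗ ℕ) :=
  if h : f.vars.Nonempty then ((toLex (leader f h, leadDeg f h) : DVar n (OpIdx m) ×ₗ ℕ) :
    WithBot (DVar n (OpIdx m) ×ₗ ℕ)) else ⊥

/-! ### Reduction, autoreduced sets, characteristic sets -/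

/-- `g` is reduced with respect to `f ∉ R`. -/
def IsReduced (g f : DPoly n (OpIdx m) R) : Prop :=
  ∀ h : f.vars.Nonempty,
    (∀ v ∈ g.vars, ¬ IsDeltaTransform (leader f h) v) ∧
    (∀ v ∈ g.vars, IsSigmaTransform (leader f h) v → g.degreeOf v < leadDeg f h)

/-- Autoreduced sets: no element lies in `R`, and each element is reduced with respect to every
other one. -/
def IsAutoreduced (A : Set (DPoly n (OpIdx m) R)) : Prop :=
  (∀ f ∈ A, f ∉ Set.range (MvPolynomial.C : R → DPoly n (OpIdx m) R)) ∧
  ∀ f ∈ A, ∀ g ∈ A, f ≠ g → IsReduced f g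

/-- `A = {a 0, …, a (k - 1)}` is listed by increasing rank. -/
def IsListing (A : Set (DPoly n (OpIdx m) R)) (k : ℕ) (a : Fin k → DPoly n (OpIdx m) R) : Prop :=
  Set.range a = A ∧ ∀ i j, i < j → rk (a i) < rk (a j)

/-- The relation `A ≺ B` between autoreduced sets. -/
def Lower (A B : Set (DPoly n (OpIdx m) R)) : Prop :=
  ∃ (k l : ℕ) (a : Fin k → DPoly n (OpIdx m) R) (b : Fin l → DPoly n (OpIdx m) R),
    IsListing A k a ∧ IsListing B l b ∧
    ((∃ (i : ℕ) (hik : i < k) (hil : i < l), rk (a ⟨i, hik⟩) < rk (b ⟨i, hil⟩) ∧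
        ∀ (j : ℕ) (hj : j < i),
          rk (a ⟨j, hj.trans hik⟩) = rk (b ⟨j, hj.trans hil⟩)) ∨
      (∃ hlk : l < k, ∀ (i : ℕ) (hi : i < l), rk (a ⟨i, hi.trans hlk⟩) = rk (b ⟨i, hi⟩)))

/-- The collection `ℬ_I` of the autoreduced subsets of `I` none of whose elements has its
separant in `I`. -/
def autoreducedIn (I : Ideal (DPoly n (OpIdx m) R)) : Set (Set (DPoly n (OpIdx m) R)) :=
  {A | IsAutoreduced A ∧ A ⊆ I ∧ ∀ f ∈ A, separant f ∉ I}

/-- A characteristic set of `I`: a minimal element of `ℬ_I`. -/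
def IsCharacteristicSet (I : Ideal (DPoly n (OpIdx m) R)) (C : Set (DPoly n (OpIdx m) R)) : Prop :=
  C ∈ autoreducedIn I ∧ ∀ A ∈ autoreducedIn I, ¬ Lower A C

/-- `H = ∏ c ∈ C, I_c * s_c`, for a finite set `C`. -/
def initSepProd (C : Set (DPoly n (OpIdx m) R)) : DPoly n (OpIdx m) R :=
  ∏ᶠ c ∈ C, initial c * separant c

end Rankings

end DStar

end

open scoped TensorProduct

noncomputable section

namespace DStar

/-! ### The operators as coordinates of `e`. -/

section Coordinates

variable {K : Type*} [Field K] {D : Type*} [CommRing D] [Algebra K D]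
variable {R : Type*} [CommRing R] [Algebra K R]

/-! Write `I` for the reflexive 𝒟-ideal generated by the characteristic set together with `P ∩ R`,
and `Q = I : H^∞`. Since `P` is prime, reflexive and contains the generators, `Q ≤ P` follows once
`H ∉ P`. The other inclusion is a pseudo-division whose remainders have coefficients in `P`.

Two facts carry the proof. The first is minimality (`IsCharacteristicSet.C_coeff_mem`): a `g ∈ P`
reduced with respect to the characteristic set has all its coefficients in `P`. Otherwise-minimal
ranks force `separant g ∈ P`, and then induction on the degree applies to the derivative of `g` and
to its part free of the leader; rational denominators recover the coefficients of `g`. If an initial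
lay in `P`, removing the leading term of `f` would leave such a reduced `g`, and the separant of `f`
would lie in `P`, which is excluded. So neither initials nor separants lie in `P`, and neither does
`H`. Finiteness is Dickson's lemma applied to leaders and degrees.

The second is the supply of divisors (`HasReducer.shift`). A `σ`-operator preserves the degree in
the leader and twists the initial by `σ_i`. An operator `δ_{i,j}`, `j ≥ 1`, makes `F` linear in its
new leader with initial `σ_i (∂F/∂v)`, because the remaining terms of the product rule involve only
operators of smaller `nu`. Thus `I` contains a divisor for every obstruction to being reduced, and
its initial is, up to units, an iterated `σ`-image of an initial or separant. These images need not
divide `H`, but reflexivity makes them nonzerodivisors modulo `Q` (`Cancels.sigmaHom`), so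
multiplying by them during division is harmless (`le_of_reduction`). -/

theorem coord_zero {κ : Type*} (e : R →ₐ[K] R ⊗[K] D) (b : Module.Basis κ K D) (k : κ) :
    coord e b k 0 = 0 := by
  simp [coord]

theorem coord_add {κ : Type*} (e : R →ₐ[K] R ⊗[K] D) (b : Module.Basis κ K D) (k : κ) (r s : R) :
    coord e b k (r + s) = coord e b k r + coord e b k s := by
  simp [coord]

theorem coord_mul {κ : Type*} [Fintype κ] (e : R →ₐ[K] R ⊗[K] D) (b : Module.Basis κ K D) (k : κ)
    (r s : R) :
    coord e b k (r * s) =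
      ∑ p, ∑ q, algebraMap K R (b.repr (b p * b q) k) * (coord e b p r * coord e b q s) := by
  have h : ∀ r : R, e r = ∑ p, coord e b p r ⊗ₜ[K] b p := by
    intro r
    conv_lhs => rw [← (Algebra.TensorProduct.basis R b).sum_repr (e r)]
    refine Finset.sum_congr rfl fun p _ => ?_
    rw [Algebra.TensorProduct.basis_apply, TensorProduct.smul_tmul', smul_eq_mul, mul_one]
    rfl
  have hrs : coord e b k (r * s) =
      (Algebra.TensorProduct.basis R b).repr
        ((∑ p, coord e b p r ⊗ₜ[K] b p) * ∑ q, coord e b q s ⊗ₜ[K] b q) k := by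
    rw [← h r, ← h s, ← map_mul]
    rfl
  rw [hrs, Finset.sum_mul_sum]
  simp only [Algebra.TensorProduct.tmul_mul_tmul, map_sum, Finsupp.coe_finsetSum,
    Finset.sum_apply, Algebra.TensorProduct.basis_repr_tmul, Finsupp.smul_apply,
    Finsupp.mapRange_apply, smul_eq_mul]
  refine Finset.sum_congr rfl fun p _ => Finset.sum_congr rfl fun q _ => ?_
  rw [mul_comm]

theorem coord_algebraMap {κ : Type*} (e : R →ₐ[K] R ⊗[K] D) (b : Module.Basis κ K D) (k : κ)
    (c : K) : coord e b k (algebraMap K R c) = algebraMap K R (c * b.repr 1 k) := by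
  unfold coord
  rw [AlgHom.commutes, Algebra.TensorProduct.algebraMap_apply,
    Algebra.TensorProduct.basis_repr_tmul]
  simp [Algebra.smul_def]

theorem coord_one {κ : Type*} (e : R →ₐ[K] R ⊗[K] D) (b : Module.Basis κ K D) (k : κ) :
    coord e b k 1 = algebraMap K R (b.repr 1 k) := by
  simpa using coord_algebraMap e b k 1

theorem IsDIdeal.coord_mem {κ : Type*} {e : R →ₐ[K] R ⊗[K] D} {I : Ideal R} (hI : IsDIdeal e I)
    (b : Module.Basis κ K D) (k : κ) {a : R} (ha : a ∈ I) : coord e b k a ∈ I := by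
  have key : ∀ y ∈ I.map (Algebra.TensorProduct.includeLeft : R →ₐ[K] R ⊗[K] D),
      (Algebra.TensorProduct.basis R b).repr y k ∈ I := by
    intro y hy
    induction hy using Submodule.span_induction with
    | mem x hx =>
      obtain ⟨r, hr, rfl⟩ := hx
      simp only [Algebra.TensorProduct.includeLeft_apply,
        Algebra.TensorProduct.basis_repr_tmul, Finsupp.smul_apply, smul_eq_mul]
      exact I.mul_mem_right _ hr
    | zero => simp
    | add x y _ _ hx hy => simpa using I.add_mem hx hy
    -- The scalar `z` lies in `R ⊗ 𝒟`, so it mixes coordinates. A second induction, uniform in `z`,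
    -- reduces to `x = r ⊗ 1`, where `z` times `x` is `r • z`.
    | smul z x hx' hx =>
      clear hx
      revert z
      induction hx' using Submodule.span_induction with
      | mem x hx =>
        obtain ⟨r, hr, rfl⟩ := hx
        intro z
        have : z • (Algebra.TensorProduct.includeLeft : R →ₐ[K] R ⊗[K] D) r = r • z := by
          rw [smul_eq_mul, mul_comm, Algebra.smul_def]
          rfl
        simp only [this, map_smul, Finsupp.smul_apply, smul_eq_mul]
        exact I.mul_mem_right _ hr
      | zero => simp
      | add x y _ _ hx hy =>
        intro z
        simpa [mul_add] using I.add_mem (hx z) (hy z)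
      | smul w x _ hx =>
        intro z
        rw [smul_smul]
        exact hx _
  exact key _ (hI a ha)

end Coordinates

/-! ### Ranked bases and the twisted product rule. -/

section RankedBases

variable {K : Type*} [Field K]

section Local

variable {L : Type*} [CommRing L] [IsLocalRing L]

theorem exists_notMem_maximalIdeal_pow [IsArtinianRing L] {x : L} (hx : x ≠ 0) :
    ∃ N, x ∉ IsLocalRing.maximalIdeal L ^ N := by
  have h : IsNilpotent (IsLocalRing.maximalIdeal L) := by
    rw [← IsLocalRing.jacobson_eq_maximalIdeal ⊥ bot_ne_top]
    exact IsArtinianRing.isNilpotent_jacobson_bot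
  obtain ⟨N, hN⟩ := h
  exact ⟨N, by rwa [hN, Ideal.zero_eq_bot, Ideal.mem_bot]⟩

theorem nu_spec [IsArtinianRing L] {x : L} (hx : x ≠ 0) :
    x ∈ IsLocalRing.maximalIdeal L ^ nu x ∧ x ∉ IsLocalRing.maximalIdeal L ^ (nu x + 1) := by
  classical
  have h := exists_notMem_maximalIdeal_pow hx
  refine Nat.sInf_mem (s := {r : ℕ | x ∈ IsLocalRing.maximalIdeal L ^ r ∧
    x ∉ IsLocalRing.maximalIdeal L ^ (r + 1)}) ⟨Nat.find h - 1, ?_⟩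
  have h0 : Nat.find h ≠ 0 := by
    intro h0
    have := Nat.find_spec h
    simp [h0] at this
  refine ⟨?_, ?_⟩
  · by_contra hc
    have := Nat.find_min' h hc
    omega
  · rw [Nat.sub_add_cancel (Nat.pos_of_ne_zero h0)]
    exact Nat.find_spec h

theorem le_nu_of_mem [IsArtinianRing L] {x : L} (hx : x ≠ 0) {r : ℕ}
    (h : x ∈ IsLocalRing.maximalIdeal L ^ r) : r ≤ nu x := by
  by_contra hlt
  exact (nu_spec hx).2 (Ideal.pow_le_pow_right (by omega) h)

theorem nu_eq_zero_of_isUnit {x : L} (hx : IsUnit x) : nu x = 0 := by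
  refine Nat.le_zero.mp (Nat.sInf_le ⟨by simp, ?_⟩)
  simpa using hx

variable [Algebra K L] {m : ℕ} {ε : Module.Basis (Fin (m + 1)) K L}

theorem IsRankedBasis.isUnit_zero (hε : IsRankedBasis ε) : IsUnit (ε 0) := by
  obtain ⟨c, hc, h⟩ := hε.zero_mem_units
  rw [h]
  exact (IsUnit.mk0 c hc).map _

theorem IsRankedBasis.nu_zero (hε : IsRankedBasis ε) : nu (ε 0) = 0 :=
  nu_eq_zero_of_isUnit hε.isUnit_zero

theorem IsRankedBasis.nu_pos (hε : IsRankedBasis ε) {j : Fin (m + 1)} (hj : j ≠ 0) :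
    0 < nu (ε j) := by
  have := Module.Finite.of_basis ε
  have : IsArtinianRing L := IsArtinianRing.of_finite K L
  exact le_nu_of_mem (ε.ne_zero j) (by simpa using hε.mem_maximalIdeal j hj)

/-- The product lies in the power `nu (ε p) + 1` of the maximal ideal, which is spanned by the basis
elements it contains; only those occur in its expansion. -/
theorem IsRankedBasis.nu_lt_of_repr_mul_ne_zero (hε : IsRankedBasis ε) {p q j : Fin (m + 1)}
    (hq : q ≠ 0) (h : ε.repr (ε p * ε q) j ≠ 0) : nu (ε p) < nu (ε j) := by
  have := Module.Finite.of_basis ε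
  have : IsArtinianRing L := IsArtinianRing.of_finite K L
  have hmem : ε p * ε q ∈ IsLocalRing.maximalIdeal L ^ (nu (ε p) + 1) := by
    rw [pow_succ]
    exact Ideal.mul_mem_mul (nu_spec (ε.ne_zero p)).1 (hε.mem_maximalIdeal q hq)
  have hspan : ε p * ε q ∈ Submodule.span K
      (ε '' {k | ε k ∈ IsLocalRing.maximalIdeal L ^ (nu (ε p) + 1)}) := by
    have : ε p * ε q ∈ (IsLocalRing.maximalIdeal L ^ (nu (ε p) + 1)).restrictScalars K := hmem
    rw [hε.span_eq] at this
    refine Submodule.span_mono ?_ this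
    rintro _ ⟨⟨k, rfl⟩, hk⟩
    exact ⟨k, hk, rfl⟩
  have := ε.repr_support_subset_of_mem_span _ hspan (Finsupp.mem_support_iff.mpr h)
  exact le_nu_of_mem (ε.ne_zero j) this

end Local

section Union

variable {ι : Type*} [Fintype ι] {D : Type*} [CommRing D] [Algebra K D]
variable {A : ι → Type*} [∀ i, CommRing (A i)] [∀ i, Algebra K (A i)]
variable (φ : D ≃ₐ[K] (∀ i, A i)) {m : ι → ℕ} (ε : ∀ i, Module.Basis (Fin (m i + 1)) K (A i))

theorem unionBasis_repr (x : D) (k : OpIdx m) :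
    (unionBasis φ ε).repr x k = (ε k.1).repr (φ x k.1) k.2 := by
  simp [unionBasis, Pi.basis_repr]

variable {S : Type*} [CommRing S] [Algebra K S] (e : S →ₐ[K] S ⊗[K] D)

theorem coord_unionBasis_mul (i : ι) (j : Fin (m i + 1)) (r s : S) :
    coord e (unionBasis φ ε) ⟨i, j⟩ (r * s) =
      ∑ p, ∑ q, algebraMap K S ((ε i).repr (ε i p * ε i q) j) *
        (coord e (unionBasis φ ε) ⟨i, p⟩ r * coord e (unionBasis φ ε) ⟨i, q⟩ s) := by
  classical
  have hb : ∀ k : OpIdx m, φ (unionBasis φ ε k) = Pi.single k.1 (ε k.1 k.2) := by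
    intro k
    simp [unionBasis, Pi.basis_apply]
  rw [coord_mul, Fintype.sum_sigma, Finset.sum_eq_single i]
  · refine Finset.sum_congr rfl fun p _ => ?_
    rw [Fintype.sum_sigma, Finset.sum_eq_single i]
    · refine Finset.sum_congr rfl fun q _ => ?_
      simp [unionBasis_repr, hb]
    · intro i' _ hi'
      refine Finset.sum_eq_zero fun q _ => ?_
      simp [unionBasis_repr, hb, Pi.single_eq_of_ne hi'.symm]
    · simp
  · intro i' _ hi'
    refine Finset.sum_eq_zero fun p _ => Finset.sum_eq_zero fun q _ => ?_
    simp [unionBasis_repr, hb, Pi.single_eq_of_ne hi'.symm]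
  · simp

variable [∀ i, IsLocalRing (A i)]

/-- Multiplication by the scalar `ε i 0` only rescales basis elements and yields the Leibniz terms.
Every other structure constant couples operators of strictly smaller `nu`, which a ranking places
lower. -/
theorem coord_unionBasis_mul_eq_add (hε : ∀ i, IsRankedBasis (ε i)) (i : ι) {c : K}
    (hc : ε i 0 = algebraMap K (A i) c) (j : Fin (m i + 1)) :
    ∃ γ : Fin (m i) → Fin (m i) → K,
      (∀ p q, γ p q ≠ 0 → nu (ε i p.succ) < nu (ε i j) ∧ nu (ε i q.succ) < nu (ε i j)) ∧
      ∀ r s : S, coord e (unionBasis φ ε) ⟨i, j⟩ (r * s) =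
        algebraMap K S c * (if j = 0 then
          coord e (unionBasis φ ε) ⟨i, 0⟩ r * coord e (unionBasis φ ε) ⟨i, 0⟩ s else
          coord e (unionBasis φ ε) ⟨i, 0⟩ r * coord e (unionBasis φ ε) ⟨i, j⟩ s +
            coord e (unionBasis φ ε) ⟨i, j⟩ r * coord e (unionBasis φ ε) ⟨i, 0⟩ s) +
        ∑ p, ∑ q, algebraMap K S (γ p q) *
          (coord e (unionBasis φ ε) ⟨i, p.succ⟩ r * coord e (unionBasis φ ε) ⟨i, q.succ⟩ s) := by
  have h0 : ∀ q, (ε i).repr (ε i 0 * ε i q) j = if q = j then c else 0 := by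
    intro q
    rw [hc, ← Algebra.smul_def]
    simp [Finsupp.single_apply]
  have h0' : ∀ q, (ε i).repr (ε i q * ε i 0) j = if q = j then c else 0 := by
    intro q
    rw [mul_comm, h0]
  refine ⟨fun p q => (ε i).repr (ε i p.succ * ε i q.succ) j, fun p q h => ?_, fun r s => ?_⟩
  · refine ⟨(hε i).nu_lt_of_repr_mul_ne_zero (Fin.succ_ne_zero q) h,
      (hε i).nu_lt_of_repr_mul_ne_zero (q := p.succ) (Fin.succ_ne_zero p) ?_⟩
    rwa [mul_comm]
  · rw [coord_unionBasis_mul, Fin.sum_univ_succ]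
    simp only [h0]
    simp_rw [Fin.sum_univ_succ (n := m i), h0', Finset.sum_add_distrib]
    rw [← add_assoc]
    congr 1
    induction j using Fin.cases with
    | zero => simp [Fin.succ_ne_zero]
    | succ j => simp [(Fin.succ_ne_zero j).symm, apply_ite, mul_add, ite_mul]

end Union

end RankedBases

/-! ### Degrees of polynomials in single variables. -/

section Polynomials

open MvPolynomial

variable {V : Type*} {R : Type*} [CommRing R]

theorem degreeOf_le_of_coeff {v : V} {f g : MvPolynomial V R}
    (h : ∀ s, g.coeff s ≠ 0 → s v ≤ f.degreeOf v) : g.degreeOf v ≤ f.degreeOf v :=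
  degreeOf_le_iff.mpr fun s hs => h s (mem_support_iff.mp hs)

theorem le_degreeOf_of_coeff_ne_zero (v : V) {f : MvPolynomial V R} {s : V →₀ ℕ}
    (h : f.coeff s ≠ 0) : s v ≤ f.degreeOf v :=
  monomial_le_degreeOf v (mem_support_iff.mpr h)

theorem mem_supported_iff_degreeOf {s : Set V} {f : MvPolynomial V R} :
    f ∈ supported R s ↔ ∀ v, v ∉ s → f.degreeOf v = 0 := by
  simp only [mem_supported, Set.subset_def, Finset.mem_coe, mem_vars_iff_degreeOf_ne_zero]
  exact forall_congr' fun v => not_imp_comm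

theorem coeff_coeffIn (u : V) (d : ℕ) (f : MvPolynomial V R) (s : V →₀ ℕ) :
    (coeffIn u d f).coeff s = if s u = 0 then f.coeff (s + Finsupp.single u d) else 0 := by
  classical
  have hiff : ∀ t : V →₀ ℕ, (t u = d ∧ t.erase u = s) ↔
      (s u = 0 ∧ t = s + Finsupp.single u d) := by
    intro t
    constructor
    · rintro ⟨rfl, rfl⟩
      exact ⟨by simp, (Finsupp.erase_add_single u t).symm⟩
    · rintro ⟨h, rfl⟩
      refine ⟨by simp [h], ?_⟩
      ext w
      by_cases hw : w = u
      · subst hw; simp [h]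
      · simp [Finsupp.erase_ne hw]
  simp only [coeffIn, coeff_sum, coeff_monomial]
  rw [Finset.sum_filter]
  simp only [← ite_and, hiff]
  split_ifs with h
  · simp only [h, true_and]
    rw [Finset.sum_ite_eq']
    simp +contextual [eq_comm]
  · simp [h]

theorem degreeOf_coeffIn_le (u v : V) (d : ℕ) (f : MvPolynomial V R) :
    (coeffIn u d f).degreeOf v ≤ f.degreeOf v := by
  refine degreeOf_le_of_coeff fun s hs => ?_
  rw [coeff_coeffIn] at hs
  split_ifs at hs with h
  · exact le_trans (by simp) (le_degreeOf_of_coeff_ne_zero v hs)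
  · exact absurd rfl hs

theorem degreeOf_coeffIn_self (u : V) (d : ℕ) (f : MvPolynomial V R) :
    (coeffIn u d f).degreeOf u = 0 := by
  refine Nat.le_zero.mp (degreeOf_le_iff.mpr fun s hs => ?_)
  rw [mem_support_iff, coeff_coeffIn] at hs
  split_ifs at hs with h
  · exact h.le
  · exact absurd rfl hs

theorem coeff_sub_coeffIn_mul_X_pow (u : V) (d : ℕ) (f : MvPolynomial V R) (s : V →₀ ℕ) :
    (f - coeffIn u d f * X u ^ d).coeff s = if s u = d then 0 else f.coeff s := by
  classical
  rw [coeff_sub, X_pow_eq_monomial, coeff_mul_monomial', mul_one, coeff_coeffIn]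
  simp only [Finsupp.single_le_iff, Finsupp.coe_tsub, Pi.sub_apply, Finsupp.single_eq_same]
  by_cases h : s u = d
  · rw [if_pos h.ge, if_pos (by omega), if_pos h, tsub_add_cancel_of_le, sub_self]
    simpa using h.ge
  · rw [if_neg h]
    split_ifs with h1 h2
    · omega
    · simp
    · simp

theorem degreeOf_sub_coeffIn_mul_X_pow_le (u v : V) (d : ℕ) (f : MvPolynomial V R) :
    (f - coeffIn u d f * X u ^ d).degreeOf v ≤ f.degreeOf v := by
  refine degreeOf_le_of_coeff fun s hs => ?_
  rw [coeff_sub_coeffIn_mul_X_pow] at hs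
  split_ifs at hs with h
  · exact absurd rfl hs
  · exact le_degreeOf_of_coeff_ne_zero v hs

theorem degreeOf_sub_coeffIn_mul_X_pow_lt (u : V) (f : MvPolynomial V R) (h : 0 < f.degreeOf u) :
    (f - coeffIn u (f.degreeOf u) f * X u ^ f.degreeOf u).degreeOf u < f.degreeOf u := by
  rw [degreeOf_lt_iff h]
  intro s hs
  rw [mem_support_iff, coeff_sub_coeffIn_mul_X_pow] at hs
  split_ifs at hs with h'
  · exact absurd rfl hs
  · exact lt_of_le_of_ne (le_degreeOf_of_coeff_ne_zero u hs) h'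

theorem degreeOf_pderiv_le (u v : V) (f : MvPolynomial V R) :
    (pderiv u f).degreeOf v ≤ f.degreeOf v := by
  refine degreeOf_le_of_coeff fun s hs => ?_
  rw [coeff_pderiv] at hs
  exact le_trans (by simp) (le_degreeOf_of_coeff_ne_zero v (left_ne_zero_of_mul hs))

theorem degreeOf_pderiv_self_lt (u : V) (f : MvPolynomial V R) (h : 0 < f.degreeOf u) :
    (pderiv u f).degreeOf u < f.degreeOf u := by
  rw [degreeOf_lt_iff h]
  intro s hs
  rw [mem_support_iff, coeff_pderiv] at hs
  have := le_degreeOf_of_coeff_ne_zero u (left_ne_zero_of_mul hs)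
  simp only [Finsupp.coe_add, Pi.add_apply, Finsupp.single_eq_same] at this
  omega

theorem sum_degreeOf_lt {f g : MvPolynomial V R} (h : ∀ v, g.degreeOf v ≤ f.degreeOf v) {u : V}
    (hu : g.degreeOf u < f.degreeOf u) :
    ∑ v ∈ g.vars, g.degreeOf v < ∑ v ∈ f.vars, f.degreeOf v := by
  have hmem : ∀ {f : MvPolynomial V R} {v}, v ∈ f.vars ↔ f.degreeOf v ≠ 0 :=
    mem_vars_iff_degreeOf_ne_zero
  calc ∑ v ∈ g.vars, g.degreeOf v ≤ ∑ v ∈ f.vars, g.degreeOf v := by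
        refine Finset.sum_le_sum_of_subset fun v hv => ?_
        rw [hmem] at hv ⊢
        have := h v
        omega
    _ < ∑ v ∈ f.vars, f.degreeOf v :=
        Finset.sum_lt_sum (fun v _ => h v) ⟨u, by rw [hmem]; omega, hu⟩

theorem mem_of_forall_C_coeff_mem {I : Ideal (MvPolynomial V R)} {f : MvPolynomial V R}
    (h : ∀ s, C (f.coeff s) ∈ I) : f ∈ I := by
  rw [← support_sum_monomial_coeff f]
  refine I.sum_mem fun s _ => ?_
  rw [← mul_one (f.coeff s), ← C_mul_monomial]
  exact I.mul_mem_right _ (h s)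

theorem eq_C_of_vars_eq_empty {f : MvPolynomial V R} (h : f.vars = ∅) : f = C (f.coeff 0) := by
  have : f ∈ supported R (∅ : Set V) := by
    rw [mem_supported, h]
    simp
  rw [supported_empty, Algebra.mem_bot] at this
  obtain ⟨r, rfl⟩ := this
  simp [algebraMap_eq]

theorem vars_nonempty_of_notMem_range_C {f : MvPolynomial V R}
    (h : f ∉ Set.range (C : R → MvPolynomial V R)) : f.vars.Nonempty := by
  by_contra hn
  exact h ⟨_, (eq_C_of_vars_eq_empty (Finset.not_nonempty_iff_eq_empty.mp hn)).symm⟩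

theorem degreeOf_X_pow_self_le (v : V) (k : ℕ) :
    (X v ^ k : MvPolynomial V R).degreeOf v ≤ k := by
  refine degreeOf_le_iff.mpr fun s hs => ?_
  rw [X_pow_eq_monomial] at hs
  have := Finset.mem_singleton.mp (support_monomial_subset hs)
  simp [this]

/-- Injectivity of `op` keeps distinct variables from merging, so exponents cannot add up. -/
theorem degreeOf_map_le {V' : Type*} {R' : Type*} [CommRing R']
    (s : MvPolynomial V R →+* MvPolynomial V' R') {op : V → V'}
    (hop : Function.Injective op) (hC : ∀ r, s (C r) ∈ Set.range (C : R' → MvPolynomial V' R'))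
    (hX : ∀ v, ∃ c, s (X v) = C c * X (op v)) (f : MvPolynomial V R) (v : V) :
    (s f).degreeOf (op v) ≤ f.degreeOf v := by
  classical
  have hX' : ∀ w, (s (X w)).degreeOf (op v) ≤ if w = v then 1 else 0 := by
    intro w
    obtain ⟨c, hc⟩ := hX w
    rw [hc]
    refine (degreeOf_C_mul_le _ _ _).trans ?_
    split_ifs with h
    · rw [h]
      simpa using degreeOf_X_pow_self_le (R := R') (op v) 1
    · rw [degreeOf_X_of_ne]
      exact fun h' => h (hop h'.symm)
  conv_lhs => rw [← support_sum_monomial_coeff f, map_sum]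
  refine (degreeOf_sum_le _ _ _).trans (Finset.sup_le fun t ht => ?_)
  refine le_trans ?_ (monomial_le_degreeOf v ht)
  rw [monomial_eq, map_mul, Finsupp.prod, map_prod]
  obtain ⟨r, hr⟩ := hC (f.coeff t)
  rw [← hr]
  refine (degreeOf_C_mul_le _ _ _).trans ((degreeOf_prod_le _ _ _).trans ?_)
  calc ∑ w ∈ t.support, (s (X w ^ t w)).degreeOf (op v)
      ≤ ∑ w ∈ t.support, if w = v then t w else 0 := by
        refine Finset.sum_le_sum fun w _ => ?_
        rw [map_pow]
        refine (degreeOf_pow_le _ _ _).trans ?_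
        refine (Nat.mul_le_mul_left _ (hX' w)).trans ?_
        split_ifs <;> simp
    _ ≤ t v := by
        rw [Finset.sum_ite_eq']
        split_ifs <;> simp

theorem map_mem_supported {V' : Type*} {R' : Type*} [CommRing R']
    (s : MvPolynomial V R →+* MvPolynomial V' R') {A : Set V} {B : Set V'}
    (hC : ∀ r, s (C r) ∈ supported R' B) (hX : ∀ v ∈ A, s (X v) ∈ supported R' B)
    {f : MvPolynomial V R} (hf : f ∈ supported R A) : s f ∈ supported R' B := by
  rw [supported_eq_adjoin_X] at hf
  induction hf using Algebra.adjoin_induction with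
  | mem x hx =>
    obtain ⟨v, hv, rfl⟩ := hx
    exact hX v hv
  | algebraMap r => exact hC r
  | add x y _ _ hx hy => rw [map_add]; exact add_mem hx hy
  | mul x y _ _ hx hy => rw [map_mul]; exact mul_mem hx hy

/-! ### Pseudo-division along a well-ordered set of variables. -/

section Reduction

variable [LinearOrder V]

/-- `F = h * v ^ t + g`, where the variables of `h` are less than `v`, those of `g` are at most `v`,
and `g` has degree less than `t` in `v`. -/
def HasLeadingForm (v : V) (t : ℕ) (h F : MvPolynomial V R) : Prop :=
  h ∈ supported R (Set.Iio v) ∧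
    ∃ g ∈ supported R (Set.Iic v), g.degreeOf v < t ∧ F = h * X v ^ t + g

theorem exists_reduction {v : V} {t : ℕ} {h F f : MvPolynomial V R} (hF : HasLeadingForm v t h F)
    (ht : t ≤ f.degreeOf v) :
    ∃ q, (h * f - q * F).degreeOf v < f.degreeOf v ∧
      ∀ w, v < w → (h * f - q * F).degreeOf w ≤ f.degreeOf w := by
  obtain ⟨hh, g, hg, hgt, rfl⟩ := hF
  rw [mem_supported_iff_degreeOf] at hh hg
  set d := f.degreeOf v with hd
  -- This quotient cancels the top power of `v`: both `h * f` and `q * F` have leading part `h *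
  -- coeffIn v d f * X v ^ d`.
  refine ⟨coeffIn v d f * X v ^ (d - t), ?_⟩
  have heq : h * f - coeffIn v d f * X v ^ (d - t) * (h * X v ^ t + g) =
      h * (f - coeffIn v d f * X v ^ d) - coeffIn v d f * X v ^ (d - t) * g := by
    have : (X v : MvPolynomial V R) ^ d = X v ^ (d - t) * X v ^ t := by
      rw [← pow_add, Nat.sub_add_cancel ht]
    rw [this]
    ring
  have hX : ∀ w, v < w → (X v ^ (d - t) : MvPolynomial V R).degreeOf w = 0 := fun w hw =>
    degreeOf_X_pow_of_ne _ hw.ne'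
  have hXv := degreeOf_X_pow_self_le (R := R) v (d - t)
  rw [heq]
  constructor
  · refine (degreeOf_sub_le _ _ _).trans_lt (max_lt ?_ ?_)
    · refine (degreeOf_mul_le _ _ _).trans_lt ?_
      rw [hh v (by simp), zero_add]
      exact degreeOf_sub_coeffIn_mul_X_pow_lt v f (by omega)
    · refine (degreeOf_mul_le _ _ _).trans_lt ?_
      have := degreeOf_mul_le v (coeffIn v d f) (X v ^ (d - t))
      rw [degreeOf_coeffIn_self] at this
      omega
  · intro w hw
    refine (degreeOf_sub_le _ _ _).trans (max_le ?_ ?_)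
    · refine (degreeOf_mul_le _ _ _).trans ?_
      rw [hh w (by simpa using hw.le), zero_add]
      exact degreeOf_sub_coeffIn_mul_X_pow_le _ _ _ _
    · refine (degreeOf_mul_le _ _ _).trans ?_
      rw [hg w (by simpa using hw), add_zero]
      refine (degreeOf_mul_le _ _ _).trans ?_
      rw [hX w hw, add_zero]
      exact degreeOf_coeffIn_le _ _ _ _

/-- Each multiplier cancels modulo `Q`, so a remainder in `Q` puts `f` in `Q`, and multipliers need
not be collected. A division step at `v` may raise degrees in smaller variables but not in larger
ones; hence the outer induction on the variable above which no obstruction remains, and the inner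
one on the degree in it. -/
theorem le_of_reduction [WellFoundedLT V] {P J Q : Ideal (MvPolynomial V R)} (W : V → ℕ → Prop)
    (hJP : J ≤ P) (hJQ : J ≤ Q) (hpos : ∀ v t, W v t → 0 < t)
    (hW : ∀ v t, W v t → ∃ h F, HasLeadingForm v t h F ∧ F ∈ J ∧ ∀ y, h * y ∈ Q → y ∈ Q)
    (hbase : ∀ f ∈ P, (∀ v t, W v t → f.degreeOf v < t) → f ∈ Q) : P ≤ Q := by
  have main : ∀ v : V, ∀ d : ℕ, ∀ f ∈ P, f.degreeOf v ≤ d →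
      (∀ w t, v < w → W w t → f.degreeOf w < t) → f ∈ Q := by
    intro v
    induction v using WellFoundedLT.induction with
    | ind v ihv =>
    intro d
    induction d using Nat.strong_induction_on with
    | _ d ihd =>
    intro f hf hfd hfW
    by_cases hv : ∃ t, W v t ∧ t ≤ f.degreeOf v
    · obtain ⟨t, hWt, ht⟩ := hv
      obtain ⟨h, F, hF, hFJ, hQ⟩ := hW v t hWt
      obtain ⟨q, hq1, hq2⟩ := exists_reduction hF ht
      refine hQ f ?_
      have hlow : h * f - q * F ∈ Q :=
        ihd _ (hq1.trans_le hfd) _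
          (P.sub_mem (P.mul_mem_left _ hf) (P.mul_mem_left _ (hJP hFJ))) le_rfl
          fun w t hw hWt => (hq2 w hw).trans_lt (hfW w t hw hWt)
      have := Q.add_mem hlow (Q.mul_mem_left q (hJQ hFJ))
      simpa using this
    · push Not at hv
      by_cases hoff : ∃ w t, W w t ∧ t ≤ f.degreeOf w
      · classical
        have hne : (f.vars.filter fun w => ∃ t, W w t ∧ t ≤ f.degreeOf w).Nonempty := by
          obtain ⟨w, t, hWt, ht⟩ := hoff
          refine ⟨w, Finset.mem_filter.mpr ⟨?_, t, hWt, ht⟩⟩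
          have := hpos w t hWt
          rw [mem_vars_iff_degreeOf_ne_zero]
          omega
        -- The largest remaining obstruction lies below `v`, so the outer induction applies there,
        -- with no bound on the degree.
        obtain ⟨w, hw, hmax⟩ := Finset.exists_max_image _ id hne
        obtain ⟨-, t, hWt, ht⟩ := Finset.mem_filter.mp hw
        have hwv : w < v := by
          by_contra hcon
          rcases (not_lt.mp hcon).eq_or_lt with rfl | hlt
          · exact absurd ht (not_le.mpr (hv t hWt))
          · exact absurd ht (not_le.mpr (hfW w t hlt hWt))
        refine ihv w hwv _ f hf le_rfl fun w' t' hw' hWt' => ?_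
        by_contra hcon
        have hle := not_lt.mp hcon
        have := hmax w' (Finset.mem_filter.mpr ⟨?_, t', hWt', hle⟩)
        · exact absurd hw' (not_lt.mpr this)
        · have := hpos w' t' hWt'
          rw [mem_vars_iff_degreeOf_ne_zero]
          omega
      · push Not at hoff
        exact hbase f hf hoff
  intro f hf
  by_cases hne : f.vars.Nonempty
  · refine main (f.vars.max' hne) _ f hf le_rfl fun w t hw hWt => ?_
    have : w ∉ f.vars := fun hmem => absurd hw (not_lt.mpr (f.vars.le_max' w hmem))
    rw [mem_vars_iff_degreeOf_ne_zero, not_not] at this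
    rw [this]
    exact hpos w t hWt
  · refine hbase f hf fun v t hWt => ?_
    rw [eq_C_of_vars_eq_empty (Finset.not_nonempty_iff_eq_empty.mp hne), degreeOf_C]
    exact hpos v t hWt

end Reduction

end Polynomials

/-! ### Rankings, autoreduced sets and characteristic sets. -/

section Rankings

open MvPolynomial

variable {ι : Type*} {m : ι → ℕ} {n : ℕ}

theorem DVar.shift_zero {κ : Type*} (u : DVar n κ) : u.shift 0 = u := by
  ext <;> simp [DVar.shift]

theorem DVar.shift_add {κ : Type*} (u : DVar n κ) (η θ : κ →₀ ℕ) :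
    u.shift (η + θ) = (u.shift η).shift θ := by
  ext <;> simp [DVar.shift, add_assoc]

theorem DVar.op_injective {κ : Type*} (k : κ) : Function.Injective (DVar.op (n := n) k) := by
  rintro ⟨i, θ⟩ ⟨j, η⟩ h
  simpa [DVar.op, DVar.shift] using h

/-- Dickson's lemma, in the form that a finite product of well-quasi-orders is one. The auxiliary
`d` later records degrees of leaders. -/
theorem DVar.exists_shift {κ : Type*} [Finite κ] (f : ℕ → DVar n κ) (d : ℕ → ℕ) :
    ∃ i j, i < j ∧ (∃ θ, f j = (f i).shift θ) ∧ d i ≤ d j := by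
  have h1 : WellQuasiOrdered (α := Fin n) (· = ·) := Finite.wellQuasiOrdered _
  have h2 : WellQuasiOrdered (α := κ →₀ ℕ) (· ≤ ·) := wellQuasiOrdered_le
  have h3 : WellQuasiOrdered (α := ℕ) (· ≤ ·) := wellQuasiOrdered_le
  obtain ⟨i, j, hij, ha, hb, hc⟩ :=
    (h1.prod (h2.prod h3)) fun i => ((f i).idx, (f i).exp, d i)
  refine ⟨i, j, hij, ⟨(f j).exp - (f i).exp, ?_⟩, hc⟩
  ext1
  · exact ha.symm
  · exact (add_tsub_cancel_of_le hb).symm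

section Order

variable [LinearOrder (DVar n (OpIdx m))] {ν : ∀ i, Fin (m i + 1) → ℕ}

theorem IsRanking.le_shift (hν : IsRanking (n := n) ν) (u : DVar n (OpIdx m))
    (θ : OpIdx m →₀ ℕ) : u ≤ u.shift θ := by
  induction θ using Finsupp.induction_linear generalizing u with
  | zero => rw [DVar.shift_zero]
  | add η θ hη hθ => rw [DVar.shift_add]; exact (hη u).trans (hθ _)
  | single k a =>
    induction a with
    | zero => rw [Finsupp.single_zero, DVar.shift_zero]
    | succ a ih =>
      rw [Finsupp.single_add, DVar.shift_add]
      exact ih.trans (hν.lt_op _ k).le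

/-- A descending sequence would contain a variable followed by one of its transforms, yet transforms
never go down. -/
theorem IsRanking.wellFoundedLT [Finite ι] (hν : IsRanking (n := n) ν) :
    WellFoundedLT (DVar n (OpIdx m)) := by
  constructor
  rw [RelEmbedding.wellFounded_iff_isEmpty]
  refine ⟨fun f => ?_⟩
  obtain ⟨i, j, hij, ⟨θ, hθ⟩, -⟩ := DVar.exists_shift (fun k => f k) fun _ => 0
  have h1 : f j < f i := f.map_rel_iff.mpr hij
  exact absurd h1 (not_lt.mpr (hθ ▸ hν.le_shift _ _))

end Order

theorem isSigmaTransform_self (u : DVar n (OpIdx m)) : IsSigmaTransform u u :=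
  ⟨0, by simp [ordDelta], u.shift_zero.symm⟩

variable {R : Type*} [CommRing R] [LinearOrder (DVar n (OpIdx m))]

theorem leader_mem_vars (f : DPoly n (OpIdx m) R) (h : f.vars.Nonempty) : leader f h ∈ f.vars :=
  f.vars.max'_mem h

theorem le_leader {f : DPoly n (OpIdx m) R} (h : f.vars.Nonempty) {v : DVar n (OpIdx m)}
    (hv : v ∈ f.vars) : v ≤ leader f h :=
  f.vars.le_max' v hv

theorem leadDeg_pos (f : DPoly n (OpIdx m) R) (h : f.vars.Nonempty) : 0 < leadDeg f h :=
  Nat.pos_of_ne_zero (mem_vars_iff_degreeOf_ne_zero.mp (leader_mem_vars f h))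

/-- `f` is not reduced exactly when `v` has degree at least `t` for some `v`, `t` with
`ObstructsAt f v t`. -/
def ObstructsAt (f : DPoly n (OpIdx m) R) (v : DVar n (OpIdx m)) (t : ℕ) : Prop :=
  ∃ h : f.vars.Nonempty, (IsDeltaTransform (leader f h) v ∧ t = 1) ∨
    (IsSigmaTransform (leader f h) v ∧ t = leadDeg f h)

theorem ObstructsAt.pos {f : DPoly n (OpIdx m) R} {v : DVar n (OpIdx m)} {t : ℕ}
    (h : ObstructsAt f v t) : 0 < t := by
  obtain ⟨h, ⟨-, rfl⟩ | ⟨-, rfl⟩⟩ := h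
  · exact one_pos
  · exact leadDeg_pos f h

theorem isReduced_iff {g f : DPoly n (OpIdx m) R} :
    IsReduced g f ↔ ∀ v t, ObstructsAt f v t → g.degreeOf v < t := by
  constructor
  · rintro hgf v t ⟨h, ⟨hv, rfl⟩ | ⟨hv, rfl⟩⟩
    · by_contra hcon
      refine (hgf h).1 v ?_ hv
      rw [mem_vars_iff_degreeOf_ne_zero]
      omega
    · by_cases hvg : v ∈ g.vars
      · exact (hgf h).2 v hvg hv
      · rw [mem_vars_iff_degreeOf_ne_zero, not_not] at hvg
        rw [hvg]
        exact leadDeg_pos f h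
  · intro hgf h
    refine ⟨fun v hv hd => ?_, fun v _ hs => hgf v _ ⟨h, Or.inr ⟨hs, rfl⟩⟩⟩
    have := hgf v 1 ⟨h, Or.inl ⟨hd, rfl⟩⟩
    rw [mem_vars_iff_degreeOf_ne_zero] at hv
    omega

theorem IsReduced.of_degreeOf_le {g g' f : DPoly n (OpIdx m) R} (hg : IsReduced g f)
    (h : ∀ v, g'.degreeOf v ≤ g.degreeOf v) : IsReduced g' f :=
  isReduced_iff.mpr fun v t ht => (h v).trans_lt (isReduced_iff.mp hg v t ht)

theorem IsReduced.leadDeg_lt {g f : DPoly n (OpIdx m) R} (hgf : IsReduced g f)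
    (hg : g.vars.Nonempty) (hf : f.vars.Nonempty) (h : leader f hf = leader g hg) :
    leadDeg g hg < leadDeg f hf :=
  (hgf hf).2 _ (leader_mem_vars g hg) (h ▸ isSigmaTransform_self _)

theorem isReduced_of_lt_leader {ν : ∀ i, Fin (m i + 1) → ℕ} (hν : IsRanking (n := n) ν)
    {g f : DPoly n (OpIdx m) R} (h : ∀ hf : f.vars.Nonempty, ∀ v ∈ g.vars, v < leader f hf) :
    IsReduced g f := by
  intro hf
  constructor
  · rintro v hv ⟨θ, -, rfl⟩
    exact absurd (h hf _ hv) (not_lt.mpr (hν.le_shift _ _))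
  · rintro v hv ⟨θ, -, rfl⟩
    exact absurd (h hf _ hv) (not_lt.mpr (hν.le_shift _ _))

theorem rk_eq {f : DPoly n (OpIdx m) R} (h : f.vars.Nonempty) :
    rk f = ((toLex (leader f h, leadDeg f h) : DVar n (OpIdx m) ×ₗ ℕ) :
      WithBot (DVar n (OpIdx m) ×ₗ ℕ)) :=
  dif_pos h

theorem rk_lt_rk_iff {f g : DPoly n (OpIdx m) R} (hf : f.vars.Nonempty) (hg : g.vars.Nonempty) :
    rk f < rk g ↔ leader f hf < leader g hg ∨
      (leader f hf = leader g hg ∧ leadDeg f hf < leadDeg g hg) := by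
  rw [rk_eq hf, rk_eq hg, WithBot.coe_lt_coe, Prod.Lex.toLex_lt_toLex]

theorem rk_eq_rk_iff {f g : DPoly n (OpIdx m) R} (hf : f.vars.Nonempty) (hg : g.vars.Nonempty) :
    rk f = rk g ↔ leader f hf = leader g hg ∧ leadDeg f hf = leadDeg g hg := by
  rw [rk_eq hf, rk_eq hg, WithBot.coe_inj, toLex_inj, Prod.mk.injEq]

theorem IsReduced.rk_ne {g f : DPoly n (OpIdx m) R} (hgf : IsReduced g f)
    (hg : g.vars.Nonempty) (hf : f.vars.Nonempty) : rk f ≠ rk g := by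
  intro h
  obtain ⟨h1, h2⟩ := (rk_eq_rk_iff hf hg).mp h
  exact (hgf.leadDeg_lt hg hf h1).ne' h2

/-- If the leaders differ, all variables of `f` lie below every transform of the leader of `g`.
Equal leaders are impossible: `g` would then have the smaller degree. -/
theorem IsReduced.symm_of_rk_lt {ν : ∀ i, Fin (m i + 1) → ℕ} (hν : IsRanking (n := n) ν)
    {g f : DPoly n (OpIdx m) R} (hgf : IsReduced g f) (hg : g.vars.Nonempty)
    (hf : f.vars.Nonempty) (h : rk f < rk g) : IsReduced f g := by
  rcases (rk_lt_rk_iff hf hg).mp h with h | ⟨h, h'⟩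
  · exact isReduced_of_lt_leader hν fun _ v hv => (le_leader hf hv).trans_lt h
  · exact absurd h' (hgf.leadDeg_lt hg hf h).not_gt

theorem IsAutoreduced.vars_nonempty {A : Set (DPoly n (OpIdx m) R)} (hA : IsAutoreduced A)
    {f : DPoly n (OpIdx m) R} (hf : f ∈ A) : f.vars.Nonempty :=
  vars_nonempty_of_notMem_range_C (hA.1 f hf)

/-- Infinitely many elements would include two where the later leader is a transform of the earlier
and its degree is no smaller, contradicting reducedness. -/
theorem IsAutoreduced.finite [Finite ι] {A : Set (DPoly n (OpIdx m) R)} (hA : IsAutoreduced A) :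
    A.Finite := by
  by_contra hinf
  let f : ℕ ↪ A := Set.Infinite.natEmbedding A hinf
  have hne : ∀ k, (f k : DPoly n (OpIdx m) R).vars.Nonempty := fun k => hA.vars_nonempty (f k).2
  obtain ⟨i, j, hij, ⟨θ, hθ⟩, hd⟩ := DVar.exists_shift (fun k => leader (f k).1 (hne k))
    fun k => leadDeg (f k).1 (hne k)
  have hred : IsReduced (f j).1 (f i).1 := hA.2 _ (f j).2 _ (f i).2 fun h =>
    hij.ne' (f.injective (Subtype.ext h))
  rcases Nat.eq_zero_or_pos (ordDelta θ) with h0 | h0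
  · exact absurd ((hred (hne i)).2 _ (leader_mem_vars _ (hne j)) ⟨θ, h0, hθ⟩) hd.not_gt
  · exact (hred (hne i)).1 _ (leader_mem_vars _ (hne j)) ⟨θ, h0, hθ⟩

theorem IsAutoreduced.rk_injOn {A : Set (DPoly n (OpIdx m) R)} (hA : IsAutoreduced A) :
    Set.InjOn rk A := by
  intro f hf g hg h
  by_contra hne
  exact (hA.2 g hg f hf (Ne.symm hne)).rk_ne (hA.vars_nonempty hg) (hA.vars_nonempty hf) h

theorem IsAutoreduced.exists_listing [Finite ι] {A : Set (DPoly n (OpIdx m) R)}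
    (hA : IsAutoreduced A) : ∃ k a, IsListing A k a := by
  have hfin : (rk '' A).Finite := hA.finite.image _
  let o := hfin.toFinset.orderEmbOfFin rfl
  have ho : ∀ i, ∃ f ∈ A, rk f = o i := fun i =>
    (hfin.mem_toFinset.mp (hfin.toFinset.orderEmbOfFin_mem rfl i))
  choose a haA hao using ho
  refine ⟨_, a, ?_, fun i j hij => ?_⟩
  · refine Set.Subset.antisymm (Set.range_subset_iff.mpr haA) fun f hf => ?_
    have : rk f ∈ Set.range o := by
      rw [Finset.range_orderEmbOfFin, Set.Finite.coe_toFinset]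
      exact Set.mem_image_of_mem _ hf
    obtain ⟨i, hi⟩ := this
    exact ⟨i, hA.rk_injOn (haA i) hf ((hao i).trans hi)⟩
  · rw [hao, hao]
    exact o.strictMono hij

/-- Inserting `g` at its place and discarding everything of higher rank either lowers the first rank
that changes or properly extends the list. -/
theorem IsAutoreduced.lower_insert [Finite ι] {A : Set (DPoly n (OpIdx m) R)}
    (hA : IsAutoreduced A) {g : DPoly n (OpIdx m) R} (hg : g.vars.Nonempty)
    (h : ∀ f ∈ A, IsReduced g f) : Lower (insert g {f ∈ A | rk f < rk g}) A := by
  obtain ⟨l, b, hb, hbmono⟩ := hA.exists_listing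
  have hbA : ∀ i, b i ∈ A := fun i => hb ▸ Set.mem_range_self i
  classical
  have hex : ∃ k, ∀ hk : k < l, ¬ rk (b ⟨k, hk⟩) < rk g := ⟨l, fun hk => absurd hk (lt_irrefl _)⟩
  -- The number of elements of rank below `g`; `k = l` means that nothing is discarded.
  set k := Nat.find hex with hk
  have hkl : k ≤ l := Nat.find_min' hex fun hk => absurd hk (lt_irrefl _)
  have hlt : ∀ i (hi : i < k), rk (b ⟨i, hi.trans_le hkl⟩) < rk g := by
    intro i hi
    by_contra hcon
    exact Nat.find_min hex hi fun _ => hcon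
  have hge : ∀ hkl : k < l, rk g < rk (b ⟨k, hkl⟩) := fun hkl =>
    lt_of_le_of_ne (not_lt.mp (Nat.find_spec hex hkl))
      ((h _ (hbA _)).rk_ne hg (hA.vars_nonempty (hbA _))).symm
  let a : Fin (k + 1) → DPoly n (OpIdx m) R := fun i =>
    if hi : (i : ℕ) < k then b ⟨i, hi.trans_le hkl⟩ else g
  have ha1 : ∀ i (hi : i < k), a ⟨i, hi.trans (Nat.lt_succ_self k)⟩ = b ⟨i, hi.trans_le hkl⟩ :=
    fun i hi => dif_pos hi
  have ha2 : a ⟨k, Nat.lt_succ_self k⟩ = g := dif_neg (lt_irrefl k)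
  refine ⟨k + 1, l, a, b, ⟨?_, ?_⟩, ⟨hb, hbmono⟩, ?_⟩
  · ext f
    constructor
    · rintro ⟨⟨i, hi⟩, rfl⟩
      rcases (Nat.lt_succ_iff.mp hi).eq_or_lt with rfl | hi'
      · exact Or.inl ha2
      · rw [ha1 i hi']
        exact Or.inr ⟨hbA _, hlt i hi'⟩
    · rintro (rfl | ⟨hfA, hfg⟩)
      · exact ⟨_, ha2⟩
      · rw [← hb] at hfA
        obtain ⟨⟨i, hi⟩, rfl⟩ := hfA
        have hik : i < k := by
          by_contra hcon
          have hki := not_lt.mp hcon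
          refine absurd hfg (not_lt.mpr ((hge (hki.trans_lt hi)).le.trans ?_))
          rcases hki.eq_or_lt with rfl | hlt'
          · exact le_rfl
          · exact (hbmono _ _ (by simpa using hlt')).le
        exact ⟨_, ha1 i hik⟩
  · rintro ⟨i, hi⟩ ⟨j, hj⟩ hij
    have hij : i < j := hij
    have hik : i < k := by omega
    rw [ha1 i hik]
    rcases (Nat.lt_succ_iff.mp hj).eq_or_lt with rfl | hj'
    · rw [ha2]
      exact hlt i hik
    · rw [ha1 j hj']
      exact hbmono _ _ hij
  · rcases hkl.eq_or_lt with hkl' | hkl'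
    · refine Or.inr ⟨by omega, fun i hi => ?_⟩
      rw [ha1 i (by omega)]
    · refine Or.inl ⟨k, Nat.lt_succ_self k, hkl', ?_, fun j hj => ?_⟩
      · rw [ha2]
        exact hge hkl'
      · rw [ha1 j hj]

theorem IsAutoreduced.insert {ν : ∀ i, Fin (m i + 1) → ℕ} (hν : IsRanking (n := n) ν)
    {A : Set (DPoly n (OpIdx m) R)} (hA : IsAutoreduced A) {g : DPoly n (OpIdx m) R}
    (hg : g.vars.Nonempty) (h : ∀ f ∈ A, IsReduced g f) :
    IsAutoreduced (insert g {f ∈ A | rk f < rk g}) := by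
  constructor
  · rintro f (rfl | ⟨hf, -⟩)
    · rintro ⟨r, rfl⟩
      simp at hg
    · exact hA.1 f hf
  · rintro f (rfl | ⟨hf, hfg⟩) f' (rfl | ⟨hf', hfg'⟩) hne
    · exact absurd rfl hne
    · exact h f' hf'
    · exact (h f hf).symm_of_rk_lt hν hg (hA.vars_nonempty hf) hfg
    · exact hA.2 f hf f' hf' hne

/-- Otherwise `g`, with the elements of smaller rank, would be an admissible set lower than `A`. -/
theorem IsCharacteristicSet.separant_mem [Finite ι] {ν : ∀ i, Fin (m i + 1) → ℕ}
    (hν : IsRanking (n := n) ν) {P : Ideal (DPoly n (OpIdx m) R)}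
    {A : Set (DPoly n (OpIdx m) R)} (hA : IsCharacteristicSet P A) {g : DPoly n (OpIdx m) R}
    (hgP : g ∈ P) (hg : g.vars.Nonempty) (h : ∀ f ∈ A, IsReduced g f) : separant g ∈ P := by
  by_contra hs
  obtain ⟨⟨hauto, hAP, hsep⟩, hmin⟩ := hA
  refine hmin _ ⟨hauto.insert hν hg h, ?_, ?_⟩ (hauto.lower_insert hg h)
  · rintro f (rfl | ⟨hf, -⟩)
    · exact hgP
    · exact hAP hf
  · rintro f (rfl | ⟨hf, -⟩)
    · exact hs
    · exact hsep f hf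

/-- Derivatives and coefficients with respect to the leader stay reduced and have smaller total
degree. The derivative controls the monomials containing the leader; what is left is the coefficient
of its zeroth power. -/
theorem IsCharacteristicSet.C_coeff_mem [Finite ι] [Algebra ℚ R] {ν : ∀ i, Fin (m i + 1) → ℕ}
    (hν : IsRanking (n := n) ν) {P : Ideal (DPoly n (OpIdx m) R)}
    {A : Set (DPoly n (OpIdx m) R)} (hA : IsCharacteristicSet P A) {g : DPoly n (OpIdx m) R}
    (hgP : g ∈ P) (h : ∀ f ∈ A, IsReduced g f) (s : DVar n (OpIdx m) →₀ ℕ) :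
    C (g.coeff s) ∈ P := by
  induction hN : ∑ v ∈ g.vars, g.degreeOf v using Nat.strong_induction_on generalizing g s with
  | _ N ih =>
  subst hN
  by_cases hg : g.vars.Nonempty
  · set u := leader g hg with hu
    have hdeg : 0 < g.degreeOf u := leadDeg_pos g hg
    have hsep : pderiv u g ∈ P := by
      have := hA.separant_mem hν hgP hg h
      rwa [separant, dif_pos hg] at this
    have hpos : ∀ t : DVar n (OpIdx m) →₀ ℕ, t u ≠ 0 → C (g.coeff t) ∈ P := by
      intro t ht
      have hle : Finsupp.single u 1 ≤ t := by
        rw [Finsupp.single_le_iff]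
        omega
      have := ih _ (sum_degreeOf_lt (fun v => degreeOf_pderiv_le u v g)
        (degreeOf_pderiv_self_lt u g hdeg)) hsep
        (fun f hf => (h f hf).of_degreeOf_le fun v => degreeOf_pderiv_le u v g)
        (t - Finsupp.single u 1) rfl
      rw [coeff_pderiv, tsub_add_cancel_of_le hle] at this
      -- Differentiation multiplies the coefficient of `t` by the exponent `t u`, which is
      -- invertible over `ℚ`.
      have hc : (((t - Finsupp.single u 1 : DVar n (OpIdx m) →₀ ℕ) u : R) + 1) *
          algebraMap ℚ R ((t u : ℚ)⁻¹) = 1 := by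
        have h1 : (((t - Finsupp.single u 1 : DVar n (OpIdx m) →₀ ℕ) u : R) + 1) =
            algebraMap ℚ R (t u : ℚ) := by
          rw [map_natCast, ← Nat.cast_succ]
          congr 1
          simp
          omega
        rw [h1, ← map_mul, mul_inv_cancel₀ (by exact_mod_cast ht), map_one]
      have h2 := P.mul_mem_right (C (algebraMap ℚ R ((t u : ℚ)⁻¹))) this
      rwa [← C_mul, mul_assoc, hc, mul_one] at h2
    by_cases hs : s u = 0
    · have hsub : g - coeffIn u 0 g * X u ^ 0 ∈ P := mem_of_forall_C_coeff_mem fun t => by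
        rw [coeff_sub_coeffIn_mul_X_pow]
        split_ifs with ht
        · simp
        · exact hpos t ht
      have hmem : coeffIn u 0 g ∈ P := by
        simpa using P.sub_mem hgP hsub
      have := ih _ (sum_degreeOf_lt (fun v => degreeOf_coeffIn_le u v 0 g)
        (by rwa [degreeOf_coeffIn_self])) hmem
        (fun f hf => (h f hf).of_degreeOf_le fun v => degreeOf_coeffIn_le u v 0 g) s rfl
      rw [coeff_coeffIn, if_pos hs] at this
      simpa using this
    · exact hpos s hs
  · have hC := eq_C_of_vars_eq_empty (Finset.not_nonempty_iff_eq_empty.mp hg)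
    rw [hC] at hgP ⊢
    rw [coeff_C]
    split_ifs
    · exact hgP
    · simp

/-- If the initial were in `P`, so would be `g`, which is `f` without its leading term. Being
reduced, `g` has coefficients in `P`, hence so does its derivative, and then the separant of `f`
lies in `P`. -/
theorem IsCharacteristicSet.initial_notMem [Finite ι] [Algebra ℚ R]
    {ν : ∀ i, Fin (m i + 1) → ℕ} (hν : IsRanking (n := n) ν)
    {P : Ideal (DPoly n (OpIdx m) R)} {A : Set (DPoly n (OpIdx m) R)}
    (hA : IsCharacteristicSet P A) {f : DPoly n (OpIdx m) R} (hf : f ∈ A) : initial f ∉ P := by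
  intro hI
  have hauto := hA.1.1
  have hne := hauto.vars_nonempty hf
  rw [initial, dif_pos hne] at hI
  set u := leader f hne with hu
  have hpos := leadDeg_pos f hne
  set g := f - coeffIn u (leadDeg f hne) f * X u ^ leadDeg f hne with hg
  have hgle : ∀ v, g.degreeOf v ≤ f.degreeOf v := fun v =>
    degreeOf_sub_coeffIn_mul_X_pow_le u v _ f
  have hgu : g.degreeOf u < leadDeg f hne :=
    degreeOf_sub_coeffIn_mul_X_pow_lt u f hpos
  have hgP : g ∈ P := P.sub_mem (hA.1.2.1 hf) (P.mul_mem_right _ hI)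
  have hred : ∀ c ∈ A, IsReduced g c := by
    intro c hc
    by_cases hcf : c = f
    · subst hcf
      intro _
      have hvars : ∀ v ∈ g.vars, v ≤ u := fun v hv => by
        refine le_leader hne ?_
        rw [mem_vars_iff_degreeOf_ne_zero] at hv ⊢
        have := hgle v
        omega
      constructor
      · rintro v hv ⟨θ, hθ, rfl⟩
        -- A transform of `u` not exceeding `u` is `u` itself, so `θ = 0` and no `δ`-operator was
        -- applied.
        have := congrArg DVar.exp (le_antisymm (hvars _ hv) (hν.le_shift _ _))
        rw [DVar.shift, add_eq_left] at this
        simp [this, ordDelta] at hθ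
      · rintro v hv ⟨θ, hθ, rfl⟩
        have := le_antisymm (hvars _ hv) (hν.le_shift _ _)
        rw [this]
        exact hgu
    · exact (hauto.2 f hf c hc (Ne.symm hcf)).of_degreeOf_le hgle
  have hgC : ∀ s, C (g.coeff s) ∈ P := hA.C_coeff_mem hν hgP hred
  refine hA.1.2.2 f hf ?_
  rw [separant, dif_pos hne, ← hu]
  have hfg : f = g + coeffIn u (leadDeg f hne) f * X u ^ leadDeg f hne := by
    rw [hg, sub_add_cancel]
  have hI' : pderiv u (coeffIn u (leadDeg f hne) f) = 0 := by
    refine pderiv_eq_zero_of_notMem_vars ?_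
    rw [mem_vars_iff_degreeOf_ne_zero, not_not]
    exact degreeOf_coeffIn_self _ _ _
  have hg' : pderiv u g ∈ P := mem_of_forall_C_coeff_mem fun s => by
    rw [coeff_pderiv, C_mul]
    exact P.mul_mem_right _ (hgC _)
  rw [hfg, map_add, pderiv_mul, hI', zero_mul, zero_add]
  exact P.add_mem hg' (P.mul_mem_right _ hI)

end Rankings

open MvPolynomial

theorem HasLeadingForm.pderiv_eq {V R : Type*} [CommRing R] [LinearOrder V] {v : V}
    {h F : MvPolynomial V R} (hF : HasLeadingForm v 1 h F) : pderiv v F = h := by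
  obtain ⟨hh, g, -, hg, rfl⟩ := hF
  have h1 : pderiv v h = 0 := pderiv_eq_zero_of_notMem_vars fun hv =>
    lt_irrefl v (mem_supported.mp hh hv)
  have h2 : pderiv v g = 0 := pderiv_eq_zero_of_notMem_vars fun hv => by
    rw [mem_vars_iff_degreeOf_ne_zero] at hv
    omega
  simp [h1, h2]

theorem X_mem_supported_of_mem {V : Type*} (R : Type*) [CommRing R] {s : Set V} {v : V}
    (hv : v ∈ s) : (X v : MvPolynomial V R) ∈ supported R s :=
  Algebra.subset_adjoin (Set.mem_image_of_mem _ hv)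

theorem IsRanking.op_le_op {ι : Type*} {m : ι → ℕ} {n : ℕ} [LinearOrder (DVar n (OpIdx m))]
    {ν : ∀ i, Fin (m i + 1) → ℕ} (hν : IsRanking (n := n) ν) {u v : DVar n (OpIdx m)}
    (h : u ≤ v) (k : OpIdx m) : u.op k ≤ v.op k := by
  rcases h.eq_or_lt with rfl | h
  · exact le_rfl
  · exact (hν.op_lt_op _ _ k h).le

/-! ### The operators on coefficients and indeterminates. -/

section PolyHom

variable {K : Type*} [Field K] {D : Type*} [CommRing D] [Algebra K D]
variable {R : Type*} [CommRing R] [Algebra K R] {κ : Type*} {n : ℕ}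
variable (e : R →ₐ[K] R ⊗[K] D) (b : Module.Basis κ K D)

theorem basis_repr_map {S : Type*} [CommRing S] [Algebra K S] (f : R →ₐ[K] S) (x : R ⊗[K] D)
    (k : κ) : (Algebra.TensorProduct.basis S b).repr
      (Algebra.TensorProduct.map f (AlgHom.id K D) x) k =
        f ((Algebra.TensorProduct.basis R b).repr x k) := by
  induction x using TensorProduct.induction_on with
  | zero => simp
  | tmul r d =>
    rw [Algebra.TensorProduct.map_tmul, Algebra.TensorProduct.basis_repr_tmul,
      Algebra.TensorProduct.basis_repr_tmul]
    simp
  | add x y hx hy => simp [hx, hy]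

variable [Fintype κ]

theorem coord_polyHom_C (k : κ) (r : R) :
    coord (polyHom n e b) b k (C r) = C (coord e b k r) := by
  have h : polyHom n e b (C r) = Algebra.TensorProduct.map
      (IsScalarTower.toAlgHom K R (DPoly n κ R)) (AlgHom.id K D) (e r) :=
    eval₂_C _ _ _
  rw [coord, h, basis_repr_map]
  rfl

theorem coord_polyHom_X (k : κ) (u : DVar n κ) :
    coord (polyHom n e b) b k (X u) = X (u.op k) := by
  classical
  have h : polyHom n e b (X u) = ∑ k, X (u.op k) ⊗ₜ[K] b k := eval₂_X _ _ _
  rw [coord, h, map_sum, Finsupp.finsetSum_apply]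
  simp only [Algebra.TensorProduct.basis_repr_tmul, Finsupp.smul_apply, Finsupp.mapRange_apply,
    Module.Basis.repr_self, Finsupp.single_apply, apply_ite (algebraMap K (DPoly n κ R)), map_one,
    map_zero, smul_eq_mul, mul_ite, mul_one, mul_zero]
  rw [Finset.sum_ite_eq', if_pos (Finset.mem_univ k)]

end PolyHom

/-! ### The endomorphisms attached to the local factors. -/

section Sigma

variable {K : Type*} [Field K] {ι : Type*} {D : Type*} [CommRing D] [Algebra K D]
variable {A : ι → Type*} [∀ i, CommRing (A i)] [∀ i, Algebra K (A i)] [∀ i, IsLocalRing (A i)]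
variable {m : ι → ℕ} {ε : ∀ i, Module.Basis (Fin (m i + 1)) K (A i)}
variable (hε : ∀ i, IsRankedBasis (ε i))

/-- The scalar `ε i 0`. -/
def unitScalar (i : ι) : K := (hε i).zero_mem_units.choose

theorem unitScalar_ne_zero (i : ι) : unitScalar hε i ≠ 0 := (hε i).zero_mem_units.choose_spec.1

theorem basis_zero_eq (i : ι) : ε i 0 = algebraMap K (A i) (unitScalar hε i) :=
  (hε i).zero_mem_units.choose_spec.2

variable [Fintype ι] (φ : D ≃ₐ[K] (∀ i, A i))
variable {S : Type*} [CommRing S] [Algebra K S] (e : S →ₐ[K] S ⊗[K] D)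

/-- The ring endomorphism attached to the factor `A i`: the scalar multiple of the operator
`(i, 0)` which fixes `1`. -/
def sigmaHom (i : ι) : S →+* S where
  toFun a := algebraMap K S (unitScalar hε i) * coord e (unionBasis φ ε) ⟨i, 0⟩ a
  map_zero' := by rw [coord_zero, mul_zero]
  map_add' a b := by rw [coord_add, mul_add]
  map_one' := by
    -- The coordinate of `1` along `ε i 0` is the inverse scalar, which explains the normalisation.
    have h : (1 : A i) = (unitScalar hε i)⁻¹ • ε i 0 := by
      rw [basis_zero_eq hε, Algebra.smul_def, ← map_mul, inv_mul_cancel₀ (unitScalar_ne_zero hε i),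
        map_one]
    have hr : (unionBasis φ ε).repr 1 ⟨i, 0⟩ = (unitScalar hε i)⁻¹ := by
      rw [unionBasis_repr, map_one, Pi.one_apply, h]
      simp
    rw [coord_one, hr, ← map_mul, mul_inv_cancel₀ (unitScalar_ne_zero hε i), map_one]
  map_mul' a b := by
    obtain ⟨γ, hγ, h⟩ := coord_unionBasis_mul_eq_add φ ε e hε i (basis_zero_eq hε i) 0
    -- Cross terms would need `nu` below `nu (ε i 0) = 0`.
    have hzero : ∀ p q, γ p q = 0 := fun p q => by
      by_contra hne
      have := (hγ p q hne).1
      rw [(hε i).nu_zero] at this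
      omega
    rw [h]
    simp only [hzero, map_zero, zero_mul, Finset.sum_const_zero, if_true]
    ring

theorem sigmaHom_apply (i : ι) (a : S) : sigmaHom hε φ e i a =
    algebraMap K S (unitScalar hε i) * coord e (unionBasis φ ε) ⟨i, 0⟩ a := rfl

theorem coord_mul_of_ne_zero (i : ι) {j : Fin (m i + 1)} (hj : j ≠ 0) :
    ∃ γ : Fin (m i) → Fin (m i) → K,
      (∀ p q, γ p q ≠ 0 → nu (ε i p.succ) < nu (ε i j) ∧ nu (ε i q.succ) < nu (ε i j)) ∧
      ∀ r s : S, coord e (unionBasis φ ε) ⟨i, j⟩ (r * s) =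
        sigmaHom hε φ e i r * coord e (unionBasis φ ε) ⟨i, j⟩ s +
          coord e (unionBasis φ ε) ⟨i, j⟩ r * sigmaHom hε φ e i s +
        ∑ p, ∑ q, algebraMap K S (γ p q) *
          (coord e (unionBasis φ ε) ⟨i, p.succ⟩ r * coord e (unionBasis φ ε) ⟨i, q.succ⟩ s) := by
  obtain ⟨γ, hγ, h⟩ := coord_unionBasis_mul_eq_add φ ε e hε i (basis_zero_eq hε i) j
  refine ⟨γ, hγ, fun r s => ?_⟩
  rw [h, if_neg hj, sigmaHom_apply, sigmaHom_apply]
  ring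

end Sigma

/-! ### Leading forms of transforms. -/

section Transforms

variable {K : Type*} [Field K] {ι : Type*} [Fintype ι] {D : Type*} [CommRing D] [Algebra K D]
variable {A : ι → Type*} [∀ i, CommRing (A i)] [∀ i, Algebra K (A i)] [∀ i, IsLocalRing (A i)]
variable {m : ι → ℕ} {ε : ∀ i, Module.Basis (Fin (m i + 1)) K (A i)}
variable (hε : ∀ i, IsRankedBasis (ε i)) (φ : D ≃ₐ[K] (∀ i, A i))
variable {R : Type*} [CommRing R] [Algebra K R] (e : R →ₐ[K] R ⊗[K] D) {n : ℕ}

theorem sigmaHom_C (i : ι) (r : R) :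
    sigmaHom hε φ (polyHom n e (unionBasis φ ε)) i (C r) = C (sigmaHom hε φ e i r) := by
  rw [sigmaHom_apply, sigmaHom_apply, coord_polyHom_C, C_mul,
    IsScalarTower.algebraMap_apply K R (DPoly n (OpIdx m) R), algebraMap_eq]

theorem sigmaHom_X (i : ι) (u : DVar n (OpIdx m)) :
    sigmaHom hε φ (polyHom n e (unionBasis φ ε)) i (X u) =
      C (algebraMap K R (unitScalar hε i)) * X (u.op ⟨i, 0⟩) := by
  rw [sigmaHom_apply, coord_polyHom_X,
    IsScalarTower.algebraMap_apply K R (DPoly n (OpIdx m) R), algebraMap_eq]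

theorem pderiv_sigmaHom (i : ι) (u : DVar n (OpIdx m)) (f : DPoly n (OpIdx m) R) :
    pderiv (u.op ⟨i, 0⟩) (sigmaHom hε φ (polyHom n e (unionBasis φ ε)) i f) =
      C (algebraMap K R (unitScalar hε i)) *
        sigmaHom hε φ (polyHom n e (unionBasis φ ε)) i (pderiv u f) := by
  induction f using MvPolynomial.induction_on with
  | C r => simp [sigmaHom_C]
  | add f g hf hg => simp only [map_add, hf, hg, mul_add]
  | mul_X f w hf =>
    rw [map_mul, pderiv_mul, pderiv_mul, hf, sigmaHom_X, pderiv_C_mul, map_add, map_mul, map_mul,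
      sigmaHom_X]
    by_cases h : w = u
    · subst h
      rw [pderiv_X_self, pderiv_X_self, map_one]
      ring
    · rw [pderiv_X_of_ne h, pderiv_X_of_ne fun h' => h (DVar.op_injective _ h'), map_zero]
      ring

variable [LinearOrder (DVar n (OpIdx m))]

theorem HasLeadingForm.sigmaHom (hν : IsRanking (n := n) fun i j => nu (ε i j))
    {v : DVar n (OpIdx m)} {t : ℕ} {h F : DPoly n (OpIdx m) R} (hF : HasLeadingForm v t h F)
    (i : ι) : HasLeadingForm (v.op ⟨i, 0⟩) t
      (sigmaHom hε φ (polyHom n e (unionBasis φ ε)) i h *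
        C (algebraMap K R (unitScalar hε i)) ^ t)
      (sigmaHom hε φ (polyHom n e (unionBasis φ ε)) i F) := by
  obtain ⟨hh, g, hg, hgt, rfl⟩ := hF
  have hC : ∀ (B : Set (DVar n (OpIdx m))) (r : R), C r ∈ supported R B := fun B r =>
    (supported R B).algebraMap_mem r
  refine ⟨mul_mem (map_mem_supported _ (fun r => ?_) (fun w hw => ?_) hh) (pow_mem (hC _ _) _),
    DStar.sigmaHom hε φ (polyHom n e (unionBasis φ ε)) i g,
    map_mem_supported _ (fun r => ?_) (fun w hw => ?_) hg, ?_, ?_⟩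
  · rw [sigmaHom_C]
    exact hC _ _
  · rw [sigmaHom_X]
    exact mul_mem (hC _ _) (X_mem_supported_of_mem R (hν.op_lt_op _ _ _ hw))
  · rw [sigmaHom_C]
    exact hC _ _
  · rw [sigmaHom_X]
    exact mul_mem (hC _ _) (X_mem_supported_of_mem R (hν.op_le_op hw _))
  · refine (degreeOf_map_le _ (DVar.op_injective _) (fun r => ?_) (fun w => ?_) g v).trans_lt hgt
    · exact ⟨_, (sigmaHom_C hε φ e i r).symm⟩
    · exact ⟨_, sigmaHom_X hε φ e i w⟩
  · rw [map_add, map_mul, map_pow, sigmaHom_X]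
    ring

/-- Both claims are proved together by induction on `f`: the product rule for `(i, j)` has cross
terms in operators of smaller `nu`, which the first claim places below `v.op ⟨i, j⟩`. The rest is
the Leibniz rule, matched with that of `pderiv v`. -/
theorem coord_mem_supported (hν : IsRanking (n := n) fun i j => nu (ε i j))
    {v : DVar n (OpIdx m)} (i : ι) {j : Fin (m i + 1)} (hj : j ≠ 0) {f : DPoly n (OpIdx m) R}
    (hf : f ∈ supported R (Set.Iic v)) :
    (∀ p, nu (ε i p) < nu (ε i j) → coord (polyHom n e (unionBasis φ ε)) (unionBasis φ ε) ⟨i, p⟩ f ∈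
        supported R (Set.Iio (v.op ⟨i, j⟩))) ∧
      coord (polyHom n e (unionBasis φ ε)) (unionBasis φ ε) ⟨i, j⟩ f -
        sigmaHom hε φ (polyHom n e (unionBasis φ ε)) i (pderiv v f) * X (v.op ⟨i, j⟩) ∈
          supported R (Set.Iio (v.op ⟨i, j⟩)) := by
  have hK : ∀ c : K, algebraMap K (DPoly n (OpIdx m) R) c ∈
      supported R (Set.Iio (v.op ⟨i, j⟩)) := fun c => by
    rw [IsScalarTower.algebraMap_apply K R (DPoly n (OpIdx m) R)]
    exact (supported R _).algebraMap_mem _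
  have h0j : nu (ε i 0) < nu (ε i j) := by
    rw [(hε i).nu_zero]
    exact (hε i).nu_pos hj
  have hsig : ∀ a, coord (polyHom n e (unionBasis φ ε)) (unionBasis φ ε) ⟨i, 0⟩ a ∈
      supported R (Set.Iio (v.op ⟨i, j⟩)) →
      sigmaHom hε φ (polyHom n e (unionBasis φ ε)) i a ∈
        supported R (Set.Iio (v.op ⟨i, j⟩)) := fun a ha => mul_mem (hK _) ha
  rw [supported_eq_adjoin_X] at hf
  induction hf using Algebra.adjoin_induction with
  | mem x hx =>
    obtain ⟨w, hw, rfl⟩ := hx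
    refine ⟨fun p hp => ?_, ?_⟩
    · rw [coord_polyHom_X]
      exact X_mem_supported_of_mem R
        ((hν.op_lt_of_nu_lt i p j w hp).trans_le (hν.op_le_op hw _))
    · rw [coord_polyHom_X]
      rcases (Set.mem_Iic.mp hw).eq_or_lt with rfl | hlt
      · rw [pderiv_X_self, map_one, one_mul, sub_self]
        exact zero_mem _
      · rw [pderiv_X_of_ne hlt.ne, map_zero, zero_mul, sub_zero]
        exact X_mem_supported_of_mem R (hν.op_lt_op _ _ _ hlt)
  | algebraMap r =>
    rw [algebraMap_eq]
    refine ⟨fun p hp => ?_, ?_⟩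
    · rw [coord_polyHom_C]
      exact (supported R _).algebraMap_mem _
    · rw [coord_polyHom_C, pderiv_C, map_zero, zero_mul, sub_zero]
      exact (supported R _).algebraMap_mem _
  | add x y _ _ hx hy =>
    refine ⟨fun p hp => ?_, ?_⟩
    · rw [coord_add]
      exact add_mem (hx.1 p hp) (hy.1 p hp)
    · rw [coord_add, map_add, map_add, add_mul, add_sub_add_comm]
      exact add_mem hx.2 hy.2
  | mul x y _ _ hx hy =>
    have hsum : ∀ (γ : Fin (m i) → Fin (m i) → K),
        (∀ p q, γ p q ≠ 0 → nu (ε i p.succ) < nu (ε i j) ∧ nu (ε i q.succ) < nu (ε i j)) →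
        ∑ p, ∑ q, algebraMap K (DPoly n (OpIdx m) R) (γ p q) *
          (coord (polyHom n e (unionBasis φ ε)) (unionBasis φ ε) ⟨i, p.succ⟩ x *
            coord (polyHom n e (unionBasis φ ε)) (unionBasis φ ε) ⟨i, q.succ⟩ y) ∈
          supported R (Set.Iio (v.op ⟨i, j⟩)) := by
      intro γ hγ
      refine sum_mem fun p _ => sum_mem fun q _ => ?_
      by_cases h : γ p q = 0
      · rw [h, map_zero, zero_mul]
        exact zero_mem _
      · exact mul_mem (hK _) (mul_mem (hx.1 _ (hγ p q h).1) (hy.1 _ (hγ p q h).2))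
    have hsx := hsig x (hx.1 0 h0j)
    have hsy := hsig y (hy.1 0 h0j)
    refine ⟨fun p hp => ?_, ?_⟩
    · by_cases hp0 : p = 0
      · subst hp0
        obtain ⟨γ, hγ, h⟩ := coord_unionBasis_mul_eq_add φ ε (polyHom n e (unionBasis φ ε)) hε i
          (basis_zero_eq hε i) 0
        rw [h, if_pos rfl]
        exact add_mem (mul_mem (hK _) (mul_mem (hx.1 0 hp) (hy.1 0 hp)))
          (hsum γ fun p q hpq => ⟨(hγ p q hpq).1.trans hp, (hγ p q hpq).2.trans hp⟩)
      · obtain ⟨γ, hγ, h⟩ := coord_mul_of_ne_zero hε φ (polyHom n e (unionBasis φ ε)) i hp0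
        rw [h]
        exact add_mem (add_mem (mul_mem hsx (hy.1 p hp)) (mul_mem (hx.1 p hp) hsy))
          (hsum γ fun p q hpq => ⟨(hγ p q hpq).1.trans hp, (hγ p q hpq).2.trans hp⟩)
    · obtain ⟨γ, hγ, h⟩ := coord_mul_of_ne_zero hε φ (polyHom n e (unionBasis φ ε)) i hj
      rw [h, pderiv_mul, map_add, map_mul, map_mul]
      have := add_mem (add_mem (mul_mem hsx hy.2) (mul_mem hsy hx.2)) (hsum γ hγ)
      convert this using 1
      ring

theorem hasLeadingForm_coord (hν : IsRanking (n := n) fun i j => nu (ε i j))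
    {v : DVar n (OpIdx m)} (i : ι) {j : Fin (m i + 1)} (hj : j ≠ 0) {f : DPoly n (OpIdx m) R}
    (hf : f ∈ supported R (Set.Iic v)) :
    HasLeadingForm (v.op ⟨i, j⟩) 1
      (sigmaHom hε φ (polyHom n e (unionBasis φ ε)) i (pderiv v f))
      (coord (polyHom n e (unionBasis φ ε)) (unionBasis φ ε) ⟨i, j⟩ f) := by
  have h0j : nu (ε i 0) < nu (ε i j) := by
    rw [(hε i).nu_zero]
    exact (hε i).nu_pos hj
  have h := (coord_mem_supported hε φ e hν i hj hf).2
  refine ⟨?_, _, supported_mono Set.Iio_subset_Iic_self h, ?_, ?_⟩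
  · have hmem : pderiv v f ∈ supported R (Set.Iic v) := by
      rw [mem_supported_iff_degreeOf] at hf ⊢
      intro w hw
      exact Nat.le_zero.mp ((degreeOf_pderiv_le v w f).trans (hf w hw).le)
    have := (coord_mem_supported hε φ e hν i hj hmem).1 0 h0j
    rw [sigmaHom_apply, IsScalarTower.algebraMap_apply K R (DPoly n (OpIdx m) R)]
    exact mul_mem ((supported R _).algebraMap_mem _) this
  · rw [mem_supported_iff_degreeOf] at h
    rw [h _ (lt_irrefl _)]
    exact one_pos
  · rw [pow_one, add_sub_cancel]

end Transforms

/-! ### Reflexive closures, saturations and cancellation. -/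

section ReflexiveSpan

variable {K : Type*} [Field K] {D : Type*} [CommRing D] [Algebra K D]
variable {S : Type*} [CommRing S] [Algebra K S] {κ : Type*}
variable (e : S →ₐ[K] S ⊗[K] D) {σ : κ → S → S} {T : Set S}

theorem subset_reflexiveSpan : T ⊆ reflexiveSpan e σ T := fun _ ha =>
  Submodule.mem_sInf.mpr fun _ hJ => hJ.2 ha

theorem reflexiveSpan_le {I : Ideal S} (hI : IsReflexiveDIdeal e σ I) (hT : T ⊆ I) :
    reflexiveSpan e σ T ≤ I :=
  sInf_le ⟨hI, hT⟩

theorem coord_mem_reflexiveSpan {ι : Type*} (b : Module.Basis ι K D) (k : ι) {a : S}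
    (ha : a ∈ reflexiveSpan e σ T) : coord e b k a ∈ reflexiveSpan e σ T :=
  Submodule.mem_sInf.mpr fun J hJ => hJ.1.1.coord_mem b k (Submodule.mem_sInf.mp ha J hJ)

theorem mem_reflexiveSpan_of_mul_mem {a : S} (i : κ) (ha : a * σ i a ∈ reflexiveSpan e σ T) :
    a ∈ reflexiveSpan e σ T :=
  Submodule.mem_sInf.mpr fun J hJ => hJ.1.2 a i (Submodule.mem_sInf.mp ha J hJ)

end ReflexiveSpan

section Saturation

variable {S : Type*} [CommRing S]

theorem le_saturation (I : Ideal S) (s : S) : I ≤ saturation I s := fun _ ha =>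
  ⟨0, by simpa using ha⟩

theorem saturation_le_of_isPrime {I P : Ideal S} (hP : P.IsPrime) (hIP : I ≤ P) {s : S}
    (hs : s ∉ P) : saturation I s ≤ P := by
  rintro a ⟨N, hN⟩
  exact (hP.mem_or_mem (hIP hN)).resolve_right fun h => hs (hP.mem_of_pow_mem N h)

/-- `h` is a nonzerodivisor modulo `I`. -/
def Cancels (I : Ideal S) (h : S) : Prop := ∀ y, h * y ∈ I → y ∈ I

theorem Cancels.mul {I : Ideal S} {h h' : S} (hh : Cancels I h) (hh' : Cancels I h') :
    Cancels I (h * h') := fun y hy => hh' y (hh _ (by rwa [← mul_assoc]))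

theorem IsUnit.cancels (I : Ideal S) {h : S} (hh : IsUnit h) : Cancels I h := fun _ hy =>
  (I.unit_mul_mem_iff_mem hh).mp hy

theorem cancels_of_dvd (I : Ideal S) {h s : S} (hs : h ∣ s) : Cancels (saturation I s) h := by
  obtain ⟨a, rfl⟩ := hs
  rintro y ⟨N, hN⟩
  refine ⟨N + 1, ?_⟩
  have := I.mul_mem_left a hN
  convert this using 1
  ring

end Saturation

/-! ### Divisors in the reflexive ideal. -/

section Reducers

variable {ι : Type*} {m : ι → ℕ} {n : ℕ}

theorem ordDelta_add (θ η : OpIdx m →₀ ℕ) :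
    ordDelta (θ + η) = ordDelta θ + ordDelta η := by
  classical
  refine Finsupp.sum_add_index' (fun k => by simp) fun k a b => ?_
  split_ifs <;> rfl

theorem ordDelta_single (k : OpIdx m) (a : ℕ) :
    ordDelta (Finsupp.single k a) = if k.2 = 0 then 0 else a := by
  rw [ordDelta, Finsupp.sum_single_index]
  simp

variable {R : Type*} [CommRing R] [LinearOrder (DVar n (OpIdx m))]

/-- Some element of `I` has leading form `h * v ^ t`, and both `h` and its derivative in `v` are
nonzerodivisors modulo `Q`. -/
def HasReducer (I Q : Ideal (DPoly n (OpIdx m) R)) (v : DVar n (OpIdx m)) (t : ℕ) : Prop :=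
  ∃ h F, HasLeadingForm v t h F ∧ F ∈ I ∧ Cancels Q h ∧ Cancels Q (pderiv v F)

theorem hasReducer_leader {I : Ideal (DPoly n (OpIdx m) R)} {f s : DPoly n (OpIdx m) R}
    (hf : f ∈ I) (hne : f.vars.Nonempty) (hi : initial f ∣ s) (hs : separant f ∣ s) :
    HasReducer I (saturation I s) (leader f hne) (leadDeg f hne) := by
  have hle : ∀ w, w ∉ Set.Iic (leader f hne) → f.degreeOf w = 0 := fun w hw => by
    by_contra h
    exact hw (le_leader hne (mem_vars_iff_degreeOf_ne_zero.mpr h))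
  rw [initial, dif_pos hne] at hi
  rw [separant, dif_pos hne] at hs
  refine ⟨_, f, ⟨?_, f - coeffIn (leader f hne) (leadDeg f hne) f * X (leader f hne) ^
    leadDeg f hne, ?_, ?_, (add_sub_cancel _ _).symm⟩, hf, cancels_of_dvd I hi, cancels_of_dvd I hs⟩
  · rw [mem_supported_iff_degreeOf]
    intro w hw
    rcases (not_lt.mp hw).eq_or_lt with rfl | hw
    · exact degreeOf_coeffIn_self _ _ _
    · exact Nat.le_zero.mp ((degreeOf_coeffIn_le _ _ _ _).trans (hle w (not_le.mpr hw)).le)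
  · rw [mem_supported_iff_degreeOf]
    intro w hw
    exact Nat.le_zero.mp ((degreeOf_sub_coeffIn_mul_X_pow_le _ _ _ _).trans (hle w hw).le)
  · exact degreeOf_sub_coeffIn_mul_X_pow_lt _ f (leadDeg_pos f hne)

theorem initSepProd_eq {B : Set (DPoly n (OpIdx m) R)} (hB : B.Finite) :
    initSepProd B = ∏ c ∈ hB.toFinset, initial c * separant c :=
  finprod_mem_eq_finite_toFinset_prod _ hB

theorem dvd_initSepProd {B : Set (DPoly n (OpIdx m) R)} (hB : B.Finite)
    {f : DPoly n (OpIdx m) R} (hf : f ∈ B) : initial f * separant f ∣ initSepProd B := by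
  rw [initSepProd_eq hB]
  exact Finset.dvd_prod_of_mem (fun c => initial c * separant c) (hB.mem_toFinset.mpr hf)

theorem IsCharacteristicSet.initSepProd_notMem [Finite ι] [Algebra ℚ R]
    {ν : ∀ i, Fin (m i + 1) → ℕ} (hν : IsRanking (n := n) ν) {P : Ideal (DPoly n (OpIdx m) R)}
    (hP : P.IsPrime) {B : Set (DPoly n (OpIdx m) R)} (hB : IsCharacteristicSet P B) :
    initSepProd B ∉ P := by
  rw [initSepProd_eq hB.1.1.finite, hP.prod_mem_iff]
  rintro ⟨f, hf, hmem⟩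
  have hf := hB.1.1.finite.mem_toFinset.mp hf
  exact (hP.mem_or_mem hmem).elim (hB.initial_notMem hν hf) (hB.1.2.2 f hf)

end Reducers

section Transforms

variable {K : Type*} [Field K] {ι : Type*} [Fintype ι] {D : Type*} [CommRing D] [Algebra K D]
variable {A : ι → Type*} [∀ i, CommRing (A i)] [∀ i, Algebra K (A i)] [∀ i, IsLocalRing (A i)]
variable {m : ι → ℕ} {ε : ∀ i, Module.Basis (Fin (m i + 1)) K (A i)}
variable (hε : ∀ i, IsRankedBasis (ε i)) (φ : D ≃ₐ[K] (∀ i, A i))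

/-- This is where reflexivity enters: it lets `σ_i h` cancel although `σ_i h` need not divide a
power of `s`. -/
theorem Cancels.sigmaHom {S : Type*} [CommRing S] [Algebra K S] (e : S →ₐ[K] S ⊗[K] D) {T : Set S}
    {s h : S} (hh : Cancels (saturation (reflexiveSpan e
      (fun i => coord e (unionBasis φ ε) ⟨i, 0⟩) T) s) h) (i : ι) :
    Cancels (saturation (reflexiveSpan e (fun i => coord e (unionBasis φ ε) ⟨i, 0⟩) T) s)
      (sigmaHom hε φ e i h) := by
  rintro y ⟨N, hN⟩
  refine hh y ⟨N, ?_⟩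
  refine mem_reflexiveSpan_of_mul_mem e i ?_
  have hc : algebraMap K S (unitScalar hε i)⁻¹ * algebraMap K S (unitScalar hε i) = 1 := by
    rw [← map_mul, inv_mul_cancel₀ (unitScalar_ne_zero hε i), map_one]
  have heq : ∀ a, coord e (unionBasis φ ε) ⟨i, 0⟩ a =
      algebraMap K S (unitScalar hε i)⁻¹ * DStar.sigmaHom hε φ e i a := by
    intro a
    rw [sigmaHom_apply, ← mul_assoc, hc, one_mul]
  -- For `a = h * y * s ^ N`, the product of `a` with its `(i, 0)`-coordinate is a multiple of `σ_i
  -- h * y * s ^ N`.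
  have := Ideal.mul_mem_left _ (algebraMap K S (unitScalar hε i)⁻¹ *
    (h * DStar.sigmaHom hε φ e i (y * s ^ N))) hN
  simp only [heq]
  convert this using 1
  rw [mul_assoc h, map_mul]
  ring

variable {R : Type*} [CommRing R] [Algebra K R] {n : ℕ} [LinearOrder (DVar n (OpIdx m))]

/-- For `δ`-operators the new initial is `σ_i` of the old derivative, and it is also the new
derivative. Hence cancellation of the derivative must be carried along with that of the initial. -/
theorem HasReducer.op (hε : ∀ i, IsRankedBasis (ε i)) (e : R →ₐ[K] R ⊗[K] D)
    (hν : IsRanking (n := n) fun i j => nu (ε i j))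
    {T : Set (DPoly n (OpIdx m) R)} {s : DPoly n (OpIdx m) R} {I : Ideal (DPoly n (OpIdx m) R)}
    (hI : I = reflexiveSpan (polyHom n e (unionBasis φ ε))
      (fun i => coord (polyHom n e (unionBasis φ ε)) (unionBasis φ ε) ⟨i, 0⟩) T)
    {v : DVar n (OpIdx m)} {t : ℕ} (h : HasReducer I (saturation I s) v t) (k : OpIdx m) :
    HasReducer I (saturation I s) (v.op k) (if k.2 = 0 then t else 1) := by
  subst hI
  obtain ⟨h, F, hF, hFI, hh, hF'⟩ := h
  obtain ⟨i, j⟩ := k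
  have hu : IsUnit (C (algebraMap K R (unitScalar hε i)) : DPoly n (OpIdx m) R) :=
    (((unitScalar_ne_zero hε i).isUnit.map (algebraMap K R))).map C
  by_cases hj : j = 0
  · subst hj
    refine ⟨_, _, hF.sigmaHom hε φ e hν i,
      Ideal.mul_mem_left _ _ (coord_mem_reflexiveSpan _ _ _ hFI),
      (hh.sigmaHom hε φ _ i).mul (IsUnit.cancels _ (hu.pow _)), ?_⟩
    rw [pderiv_sigmaHom]
    exact (IsUnit.cancels _ hu).mul (hF'.sigmaHom hε φ _ i)
  · have hFv : F ∈ supported R (Set.Iic v) := by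
      obtain ⟨hh', g, hg, -, rfl⟩ := hF
      exact add_mem (mul_mem (supported_mono Set.Iio_subset_Iic_self hh')
        (pow_mem (X_mem_supported_of_mem R (Set.mem_Iic.mpr le_rfl)) _)) hg
    have hlead := hasLeadingForm_coord hε φ e hν i hj hFv
    have hc := hF'.sigmaHom hε φ _ i
    rw [if_neg hj]
    refine ⟨_, _, hlead, coord_mem_reflexiveSpan _ _ _ hFI, hc, ?_⟩
    rw [hlead.pderiv_eq]
    exact hc

/-- Once a `δ`-operator has acted the degree is `1`, and later operators keep it so; the order of
application does not matter. -/
theorem HasReducer.shift (hε : ∀ i, IsRankedBasis (ε i)) (e : R →ₐ[K] R ⊗[K] D)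
    (hν : IsRanking (n := n) fun i j => nu (ε i j))
    {T : Set (DPoly n (OpIdx m) R)} {s : DPoly n (OpIdx m) R} {I : Ideal (DPoly n (OpIdx m) R)}
    (hI : I = reflexiveSpan (polyHom n e (unionBasis φ ε))
      (fun i => coord (polyHom n e (unionBasis φ ε)) (unionBasis φ ε) ⟨i, 0⟩) T)
    {v : DVar n (OpIdx m)} {t : ℕ} (h : HasReducer I (saturation I s) v t) (θ : OpIdx m →₀ ℕ) :
    HasReducer I (saturation I s) (v.shift θ) (if ordDelta θ = 0 then t else 1) := by
  induction θ using Finsupp.induction_linear generalizing v t with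
  | zero =>
    rw [DVar.shift_zero]
    simpa [ordDelta] using h
  | add η θ hη hθ =>
    have := hθ (hη h)
    rw [DVar.shift_add, ordDelta_add]
    split_ifs at this ⊢ <;> first | exact this | omega
  | single k a =>
    induction a with
    | zero =>
      rw [Finsupp.single_zero, DVar.shift_zero]
      simpa [ordDelta] using h
    | succ a ih =>
      have := ih.op φ hε e hν hI k
      rw [Finsupp.single_add, DVar.shift_add, ordDelta_add]
      rw [ordDelta_single] at this ⊢
      rw [ordDelta_single]
      by_cases hk : k.2 = 0 <;> simpa [hk, DVar.op] using this

theorem le_saturation_reflexiveSpan [Algebra ℚ R] (hε : ∀ i, IsRankedBasis (ε i)) (e : R →ₐ[K] R ⊗[K] D)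
    (hν : IsRanking (n := n) fun i j => nu (ε i j)) {P : Ideal (DPoly n (OpIdx m) R)}
    {B : Set (DPoly n (OpIdx m) R)} (hB : IsCharacteristicSet P B) {s : DPoly n (OpIdx m) R}
    (hs : ∀ f ∈ B, initial f * separant f ∣ s)
    (hP : IsReflexiveDIdeal (polyHom n e (unionBasis φ ε))
      (fun i => coord (polyHom n e (unionBasis φ ε)) (unionBasis φ ε) ⟨i, 0⟩) P) :
    P ≤ saturation (reflexiveSpan (polyHom n e (unionBasis φ ε))
      (fun i => coord (polyHom n e (unionBasis φ ε)) (unionBasis φ ε) ⟨i, 0⟩)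
        (B ∪ {f | f ∈ P ∧ f ∈ Set.range (C : R → DPoly n (OpIdx m) R)})) s := by
  have := hν.wellFoundedLT
  set I := reflexiveSpan (polyHom n e (unionBasis φ ε))
      (fun i => coord (polyHom n e (unionBasis φ ε)) (unionBasis φ ε) ⟨i, 0⟩)
        (B ∪ {f | f ∈ P ∧ f ∈ Set.range (C : R → DPoly n (OpIdx m) R)}) with hI
  have hsub : B ∪ {f | f ∈ P ∧ f ∈ Set.range (C : R → DPoly n (OpIdx m) R)} ⊆ I :=
    subset_reflexiveSpan _
  have hred : ∀ f ∈ B, ∀ v t, ObstructsAt f v t → HasReducer I (saturation I s) v t := by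
    rintro f hf v t ⟨hne, hv⟩
    have hlead := hasReducer_leader (hsub (Or.inl hf)) hne ((dvd_mul_right _ _).trans (hs f hf))
      ((dvd_mul_left _ _).trans (hs f hf))
    rcases hv with ⟨⟨θ, hθ, rfl⟩, rfl⟩ | ⟨⟨θ, hθ, rfl⟩, rfl⟩
    · have := hlead.shift φ hε e hν hI θ
      rwa [if_neg hθ.ne'] at this
    · have := hlead.shift φ hε e hν hI θ
      rwa [if_pos hθ] at this
  refine le_of_reduction (J := I) (fun v t => ∃ f ∈ B, ObstructsAt f v t)
    (reflexiveSpan_le _ hP (Set.union_subset hB.1.2.1 fun f hf => hf.1)) (le_saturation I s)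
    ?_ ?_ ?_
  · rintro v t ⟨f, -, h⟩
    exact h.pos
  · rintro v t ⟨f, hf, h⟩
    obtain ⟨h, F, hF, hFI, hh, -⟩ := hred f hf v t h
    exact ⟨h, F, hF, hFI, hh⟩
  · intro g hg hgred
    -- A fully reduced element of `P` has coefficients in `P ∩ R`, which are among the generators.
    refine le_saturation I s (mem_of_forall_C_coeff_mem fun r => hsub (Or.inr ⟨?_, _, rfl⟩))
    exact hB.C_coeff_mem hν hg
      (fun f hf => isReduced_iff.mpr fun v t h => hgred v t ⟨f, hf, h⟩) r

end Transforms

end DStar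

end

theorem mainTheorem5
    {K : Type*} [Field K]
    {D : Type*} [CommRing D] [Algebra K D] [FiniteDimensional K D]
    {ι : Type*} [Fintype ι]
    {A : ι → Type*} [∀ i, CommRing (A i)] [∀ i, Algebra K (A i)] [∀ i, IsLocalRing (A i)]
    (φ : D ≃ₐ[K] (∀ i, A i))
    (hres : ∀ i, Function.Bijective (algebraMap K (IsLocalRing.ResidueField (A i))))
    {m : ι → ℕ} (ε : ∀ i, Module.Basis (Fin (m i + 1)) K (A i))
    (hε : ∀ i, DStar.IsRankedBasis (ε i))
    {R : Type*} [CommRing R] [Algebra K R] [Algebra ℚ R]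
    (e : R →ₐ[K] TensorProduct K R D)
    (he : DStar.IsCommuting e)
    (hinj : ∀ i, Function.Injective (DStar.coord e (DStar.unionBasis φ ε) ⟨i, 0⟩))
    (n : ℕ) [LinearOrder (DStar.DVar n (DStar.OpIdx m))]
    (hrank : DStar.IsRanking (n := n) (fun i j => DStar.nu (ε i j)))
    (P : Ideal (DStar.DPoly n (DStar.OpIdx m) R)) (hprime : P.IsPrime)
    (hperfect : DStar.IsPerfectDIdeal (DStar.polyHom n e (DStar.unionBasis φ ε))
      (fun i => DStar.coord (DStar.polyHom n e (DStar.unionBasis φ ε))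
        (DStar.unionBasis φ ε) ⟨i, 0⟩) P)
    (C : Set (DStar.DPoly n (DStar.OpIdx m) R)) (hC : DStar.IsCharacteristicSet P C) :
    C.Finite ∧ DStar.initSepProd C ∉ P ∧
      P = DStar.saturation
        (DStar.reflexiveSpan (DStar.polyHom n e (DStar.unionBasis φ ε))
          (fun i => DStar.coord (DStar.polyHom n e (DStar.unionBasis φ ε))
            (DStar.unionBasis φ ε) ⟨i, 0⟩)
          (C ∪ {f | f ∈ P ∧ f ∈ Set.range (MvPolynomial.C : R → DStar.DPoly n (DStar.OpIdx m) R)}))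
        (DStar.initSepProd C) := by
  have hfin := hC.1.1.finite
  have hH := hC.initSepProd_notMem hrank hprime
  refine ⟨hfin, hH, le_antisymm ?_ ?_⟩
  · exact DStar.le_saturation_reflexiveSpan φ hε e hrank hC
      (fun f hf => DStar.dvd_initSepProd hfin hf) hperfect.1
  · exact DStar.saturation_le_of_isPrime hprime (DStar.reflexiveSpan_le _ hperfect.1
      (Set.union_subset hC.1.2.1 fun f hf => hf.1)) hH
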